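/- Let $\mathcal X$ be a complete separable metric space with its Borel $\sigma$-algebra, $\mathcal M(\mathcal X)$ and $\mathcal P(\mathcal X)$ the finite and the probability Borel measures on it, $B_b(\mathcal X)$ the bounded Borel functions $\mathcal X\to\mathbb R$, and $B(x,r)$ the open balls; write $\langle f,\mu\rangle=\int f\,d\mu$. Let $\{P_t\}_{t\ge 0}$ be a Markov–Feller semigroup on $\mathcal X$: each $P_t:\mathcal M(\mathcal X)\to\mathcal M(\mathcal X)$ satisfies $P_t(a\mu+b\nu)=aP_t\mu+bP_t\nu$ for $a,b\ge 0$ and $P_t\mu(\mathcal X)=\mu(\mathcal X)$; there is a linear operator on $B_b(\mathcal X)$, again denoted $P_t$, with $\langle f,P_t\mu\rangle=\langle P_tf,\mu\rangle$ for all $f\in B_b(\mathcal X)$ and $\mu\in\mathcal M(\mathcal X)$, and it maps bounded continuous functions to bounded continuous functions; $P_0$ is the identity, $P_{s+t}=P_sP_t$; and $t\mapsto P_t\mu(A)$ is measurable for every $\mu\in\mathcal M(\mathcal X)$ and Borel set $A$. For $t>0$ put $$Q_tf(x)=\frac1t\int_0^tP_sf(x)\,ds,\qquad Q_t\mu=\frac1t\int_0^tP_s\mu\,ds,\qquad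 Q_t(x,\cdot)=Q_t\delta_x ,$$ and let $\mathcal T=\{x\in\mathcal X:\ \{Q_t(x,\cdot)\}_{t>0}\text{ is tight}\}$. A measure $\mu\in\mathcal P(\mathcal X)$ is called invariant if $P_t\mu=\mu$ for all $t\ge 0$. Theorem. Assume that $\{P_t\}_{t\ge 0}$ is Cesàro eventually continuous on $\mathcal X$, that is, for every $z\in\mathcal X$ and every bounded Lipschitz function $f:\mathcal X\to\mathbb R$, $$\limsup_{x\to z}\ \limsup_{t\to\infty}|Q_tf(x)-Q_tf(z)|=0 .$$ (i) If there is $z\in\mathcal X$ such that $\limsup_{t\to\infty}Q_t(z,B(z,\varepsilon))>0$ for every $\varepsilon>0$, then $\mathcal T\ne\emptyset$, and $\{P_t\}_{t\ge 0}$ admits an invariant probability measure. (ii) If $z\in\mathcal X$ is such that $\limsup_{t\to\infty}Q_t(x,B(z,\varepsilon))>0$ for every $x\in\mathcal X$ and every $\varepsilon>0$, then $\{P_t\}_{t\ge 0}$ admits exactly one invariant probability measure $\mu_*$. Moreover, $z\in\operatorname{supp}\mu_*$, and for every $\nu\in\mathcal P(\mathcal X)$ with $\operatorname{supp}\nu\subset\mathcal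 T$ the measures $Q_t\nu$ converge weakly to $\mu_*$ as $t\to\infty$, that is, $\langle f,Q_t\nu\rangle\to\langle f,\mu_*\rangle$ for every bounded continuous $f:\mathcal X\to\mathbb R$. -/

import Mathlib

open MeasureTheory Filter Topology
open scoped NNReal ENNReal

noncomputable section

/-- The space `B_b(X)` of bounded Borel measurable real-valued functions on `X`. -/
def boundedBorel (X : Type*) [MeasurableSpace X] : Submodule ℝ (X → ℝ) where
  carrier := {f | Measurable f ∧ ∃ C : ℝ, ∀ x, |f x| ≤ C}
  zero_mem' := ⟨measurable_const, 0, fun x => by simp⟩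
  add_mem' := by
    rintro f g ⟨hf, C, hC⟩ ⟨hg, D, hD⟩
    exact ⟨hf.add hg, C + D, fun x => (abs_add_le _ _).trans (add_le_add (hC x) (hD x))⟩
  smul_mem' := by
    rintro c f ⟨hf, C, hC⟩
    refine ⟨hf.const_smul c, |c| * C, fun x => ?_⟩
    simpa [abs_mul] using mul_le_mul_of_nonneg_left (hC x) (abs_nonneg c)

/-- A Markov operator on the finite Borel measures of `X`: positively linear and
preserving the total mass. -/
structure IsMarkovOperator {X : Type*} [MeasurableSpace X]
    (P : FiniteMeasure X → FiniteMeasure X) : Prop where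
  map_combination : ∀ (a b : ℝ≥0) (μ ν : FiniteMeasure X),
    P (a • μ + b • ν) = a • P μ + b • P ν
  map_mass : ∀ μ : FiniteMeasure X, (P μ).mass = μ.mass

/-- `Pd : B_b(X) → B_b(X)` is the dual operator of `P`: `⟨f, P μ⟩ = ⟨Pd f, μ⟩`. A Markov operator
is regular if it has a dual operator, which is then unique. -/
def IsDualOperator {X : Type*} [MeasurableSpace X] (P : FiniteMeasure X → FiniteMeasure X)
    (Pd : boundedBorel X →ₗ[ℝ] boundedBorel X) : Prop :=
  ∀ (f : boundedBorel X) (μ : FiniteMeasure X),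
    ∫ x, (f : X → ℝ) x ∂(P μ : Measure X) = ∫ x, (Pd f : X → ℝ) x ∂(μ : Measure X)

/-- A Markov–Feller semigroup `(P_t)_{t ≥ 0}`, acting on finite measures by `op t` and on bounded
Borel functions by the dual operators `dual t`. -/
structure MarkovFellerSemigroup (X : Type*) [TopologicalSpace X] [MeasurableSpace X] where
  /-- the action `μ ↦ P_t μ` -/
  op : ℝ≥0 → FiniteMeasure X → FiniteMeasure X
  /-- the action `f ↦ P_t f` -/
  dual : ℝ≥0 → boundedBorel X →ₗ[ℝ] boundedBorel X
  isMarkovOperator : ∀ t, IsMarkovOperator (op t)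
  isDualOperator : ∀ t, IsDualOperator (op t) (dual t)
  /-- `P_t` maps bounded continuous functions to (bounded) continuous functions. -/
  feller : ∀ (t : ℝ≥0) (f : boundedBorel X),
    Continuous (f : X → ℝ) → Continuous (dual t f : X → ℝ)
  op_zero : ∀ μ, op 0 μ = μ
  op_add : ∀ s t μ, op (s + t) μ = op s (op t μ)
  /-- Measurability in time, without which the time averages of `P_t μ` are not defined. -/
  measurable_op : ∀ (μ : FiniteMeasure X) (A : Set X), MeasurableSet A →
    Measurable fun t : ℝ≥0 => (op t μ : Measure X) A

namespace MarkovFellerSemigroup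

variable {X : Type*} [TopologicalSpace X] [MeasurableSpace X]

/-- `Q_t f (x) = (1/t) ∫_0^t P_s f (x) ds`, for `t > 0`. -/
def cesaroFun (P : MarkovFellerSemigroup X) (t : ℝ) (f : boundedBorel X) (x : X) : ℝ :=
  t⁻¹ * ∫ s in (0 : ℝ)..t, (P.dual s.toNNReal f : X → ℝ) x

/-- `Q_t μ = (1/t) ∫_0^t P_s μ ds`, for `t > 0`. -/
def cesaroMeasure (P : MarkovFellerSemigroup X) (t : ℝ) (μ : ProbabilityMeasure X) : Measure X :=
  (ENNReal.ofReal t)⁻¹ • (volume.restrict (Set.Ioc 0 t)).bind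
    fun s => (P.op s.toNNReal μ.toFiniteMeasure : Measure X)

/-- `Q_t μ (A) = (1/t) ∫_0^t P_s μ (A) ds`. -/
theorem cesaroMeasure_apply (P : MarkovFellerSemigroup X) (t : ℝ) (μ : ProbabilityMeasure X)
    {A : Set X} (hA : MeasurableSet A) :
    P.cesaroMeasure t μ A = (ENNReal.ofReal t)⁻¹ *
      ∫⁻ s in Set.Ioc 0 t, (P.op s.toNNReal μ.toFiniteMeasure : Measure X) A := by
  have h : Measurable fun s : ℝ => (P.op s.toNNReal μ.toFiniteMeasure : Measure X) :=
    Measure.measurable_of_measurable_coe _ fun B hB =>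
      (P.measurable_op μ.toFiniteMeasure B hB).comp measurable_real_toNNReal
  simp [cesaroMeasure, Measure.bind_apply hA h.aemeasurable]

/-- `μ` is an invariant (probability) measure of the semigroup. -/
def IsInvariant (P : MarkovFellerSemigroup X) (μ : ProbabilityMeasure X) : Prop :=
  ∀ t, P.op t μ.toFiniteMeasure = μ.toFiniteMeasure

/-- The set `𝒯` of the points `x` for which the family `Q_t(x, ·) = Q_t δ_x`, `t > 0`, is tight. -/
def tightPoints (P : MarkovFellerSemigroup X) : Set X :=
  {x | IsTightMeasureSet {m | ∃ t : ℝ, 0 < t ∧ m = P.cesaroMeasure t (diracProba x)}}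

/-- Cesàro eventual continuity at `z`: for every bounded Lipschitz function `f`,
`limsup_{x → z} limsup_{t → ∞} |Q_t f (x) - Q_t f (z)| = 0`. -/
def CesaroEventuallyContinuousAt {X : Type*} [MetricSpace X] [MeasurableSpace X]
    (P : MarkovFellerSemigroup X) (z : X) : Prop :=
  ∀ f : boundedBorel X, (∃ K : ℝ≥0, LipschitzWith K (f : X → ℝ)) →
    ∀ ε : ℝ, 0 < ε → ∃ δ : ℝ, 0 < δ ∧ ∀ x ∈ Metric.ball z δ, ∃ T : ℝ, ∀ t : ℝ, T ≤ t →
      |P.cesaroFun t f x - P.cesaroFun t f z| ≤ ε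

end MarkovFellerSemigroup

end

/-! ### Integrals against kernels and time averages. -/

open ProbabilityTheory Set

/-! The operators `P_t` are integration against Markov kernels, and `Q_r` almost commutes with the
semigroup: composing `Q_r` and `Q_t` in either order changes `Q_t f` by at most `2Cr/t` when `|f| ≤
C`.

Existence. The core is tightness of `Q_t(z, ·)`, `t ≥ 1`, at a recurrent point `z`
(`isTightMeasureSet_cesaroKernel`). Otherwise there are times `t_i → ∞` and uniformly separated sets
`C_i` with `Q_{t_i}(z, C_i) ≥ c > 0`. Let `f_i` be Lipschitz bumps equal to 1 on `C_i`, with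
disjoint supports. Since the `f_i` add up to at most 1, recurrence and a Baire argument on the
points reachable from `z` yield points `y_k → z` with `Q_{t_i} f_i (y_k) < c/2` for infinitely many
`i`. A gliding hump then selects one set `I` of indices for which `F = ∑_{i ∈ I} f_i`, still
Lipschitz, has `|Q_{t_i} F(z) - Q_{t_i} F(y_k)| ≥ c/8` for infinitely many `i`, for all `k` at once.
This contradicts Cesàro eventual continuity at `z`. Krylov–Bogoliubov now gives an invariant
measure.

No continuity in time is assumed, so this says nothing about `Q_t(z, ·)` as `t → 0`, which
membership in `𝒯` also involves. Points of `𝒯` come instead from Hopf's maximal inequality and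
Borel–Cantelli: almost every point of an invariant measure lies in `𝒯` (`ae_mem_tightPoints`).

Uniqueness. For Lipschitz `f` the oscillation `limsup_n |Q_n f(x) - Q_n f(z)|` is subharmonic, so
for an invariant `ν` its sublevel sets at positive levels are absorbing `ν`-almost everywhere. They
contain a ball about `z`, which is reached from every point, so the oscillation vanishes `ν`-almost
everywhere. Integrating, `Q_n f(z) → ⟨f, ν⟩`, which determines `ν`. For `x ∈ 𝒯` tightness and
uniqueness give `Q_t(x, ·) → μ`, and dominated convergence extends this to initial laws supported in
`𝒯`. -/

/-- The integral of a bounded measurable function against the composition of a measure and a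
Markov kernel is the iterated integral. -/
theorem integral_bind_kernel {α β : Type*} [MeasurableSpace α] [MeasurableSpace β]
    (m : Measure α) [IsFiniteMeasure m] (κ : Kernel α β) [IsMarkovKernel κ] {f : β → ℝ} {C : ℝ}
    (hf : Measurable f) (hC : ∀ x, |f x| ≤ C) :
    ∫ y, f y ∂(m.bind κ) = ∫ x, ∫ y, f y ∂(κ x) ∂m := by
  have h : (m.bind κ) = (κ ∘ₖ Kernel.const Unit m) () := Measure.comp_eq_comp_const_apply
  have hi : Integrable f ((κ ∘ₖ Kernel.const Unit m) ()) :=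
    Integrable.of_bound hf.aestronglyMeasurable C (Eventually.of_forall hC)
  rw [h, Kernel.integral_comp hi]
  simp

theorem abs_integral_le_of_abs_le {α : Type*} [MeasurableSpace α] (m : Measure α)
    [IsProbabilityMeasure m] {f : α → ℝ} {C : ℝ} (hC : ∀ x, |f x| ≤ C) :
    |∫ x, f x ∂m| ≤ C := by
  simpa using norm_integral_le_of_norm_le_const (μ := m) (f := f) (C := C)
    (Eventually.of_forall hC)

theorem integrable_of_abs_le {α : Type*} [MeasurableSpace α] (m : Measure α)
    [IsFiniteMeasure m] {f : α → ℝ} {C : ℝ} (hf : Measurable f) (hC : ∀ x, |f x| ≤ C) :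
    Integrable f m :=
  Integrable.of_bound hf.aestronglyMeasurable C (Eventually.of_forall hC)

theorem abs_indicator_one_le_one {X : Type*} (A : Set X) (x : X) :
    |A.indicator (fun _ => (1 : ℝ)) x| ≤ 1 := by
  by_cases h : x ∈ A <;> simp [h]

/-- The uniform distribution on `(0, t]`. -/
noncomputable def uniformTime (t : ℝ) : Measure ℝ :=
  (ENNReal.ofReal t)⁻¹ • volume.restrict (Ioc 0 t)

theorem isProbabilityMeasure_uniformTime {t : ℝ} (ht : 0 < t) :
    IsProbabilityMeasure (uniformTime t) := by
  constructor
  simp only [uniformTime, Measure.smul_apply, Measure.restrict_apply_univ, Real.volume_Ioc,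
    sub_zero, smul_eq_mul]
  exact ENNReal.inv_mul_cancel (by simpa using ht) ENNReal.ofReal_ne_top

theorem integral_uniformTime {t : ℝ} (ht : 0 < t) (F : ℝ → ℝ) :
    ∫ s, F s ∂(uniformTime t) = t⁻¹ * ∫ s in (0 : ℝ)..t, F s := by
  rw [uniformTime, integral_smul_measure, intervalIntegral.integral_of_le ht.le, smul_eq_mul]
  simp [ENNReal.toReal_inv, ENNReal.toReal_ofReal ht.le]

theorem ae_mem_uniformTime (t : ℝ) : ∀ᵐ s ∂(uniformTime t), s ∈ Ioc 0 t :=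
  Measure.ae_smul_measure (ae_restrict_mem measurableSet_Ioc) _

/-- Shifting a bounded function changes its time average over `(0, t]` little. -/
theorem abs_integral_uniformTime_shift_sub_le {F : ℝ → ℝ} {C : ℝ} (hF : Measurable F)
    (hC : ∀ s, |F s| ≤ C) {t v : ℝ} (ht : 0 < t) (hv : 0 ≤ v) :
    |∫ s, F (s + v) ∂(uniformTime t) - ∫ s, F s ∂(uniformTime t)| ≤ 2 * C * v / t := by
  have hi : ∀ a b : ℝ, IntervalIntegrable F volume a b := fun a b =>
    (intervalIntegrable_const (c := C)).mono_fun hF.aestronglyMeasurable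
      (Eventually.of_forall fun s => (hC s).trans (le_abs_self C))
  have h1 : ∫ s in (0 : ℝ)..t, F (s + v) = ∫ s in v..(t + v), F s := by simp
  have h2 : (∫ s in v..(t + v), F s) - ∫ s in (0 : ℝ)..t, F s
      = (∫ s in t..(t + v), F s) - ∫ s in (0 : ℝ)..v, F s := by
    have e1 := intervalIntegral.integral_add_adjacent_intervals (hi 0 v) (hi v (t + v))
    have e2 := intervalIntegral.integral_add_adjacent_intervals (hi 0 t) (hi t (t + v))
    linarith
  have h3 : |∫ s in t..(t + v), F s| ≤ C * v := by
    have := intervalIntegral.norm_integral_le_of_norm_le_const (a := t) (b := t + v) (f := F)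
      (C := C) (fun s _ => hC s)
    simpa [abs_of_nonneg hv] using this
  have h4 : |∫ s in (0 : ℝ)..v, F s| ≤ C * v := by
    have := intervalIntegral.norm_integral_le_of_norm_le_const (a := 0) (b := v) (f := F)
      (C := C) (fun s _ => hC s)
    simpa [abs_of_nonneg hv] using this
  rw [integral_uniformTime ht, integral_uniformTime ht, h1, ← mul_sub, h2, abs_mul,
    abs_of_pos (inv_pos.2 ht), div_eq_inv_mul]
  refine mul_le_mul_of_nonneg_left ?_ (inv_pos.2 ht).le
  exact (abs_sub _ _).trans (by linarith)

/-! ### Transition kernels, Cesàro kernels and their almost commutation. -/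

namespace MarkovFellerSemigroup

section Kernel

variable {X : Type*} [TopologicalSpace X] [MeasurableSpace X] (P : MarkovFellerSemigroup X)

/-- A bounded measurable function as an element of `B_b(X)`. -/
def _root_.boundedBorel.mk {f : X → ℝ} {C : ℝ} (hf : Measurable f) (hC : ∀ x, |f x| ≤ C) :
    boundedBorel X :=
  ⟨f, hf, C, hC⟩

theorem dual_apply (t : ℝ≥0) (f : boundedBorel X) (x : X) :
    (P.dual t f : X → ℝ) x =
      ∫ y, (f : X → ℝ) y ∂(P.op t (diracProba x).toFiniteMeasure : Measure X) := by
  rw [P.isDualOperator t f]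
  symm
  exact integral_dirac' _ _ (P.dual t f).2.1.stronglyMeasurable

theorem isProbabilityMeasure_op (t : ℝ≥0) (μ : ProbabilityMeasure X) :
    IsProbabilityMeasure (P.op t μ.toFiniteMeasure : Measure X) := by
  constructor
  have h := (P.isMarkovOperator t).map_mass μ.toFiniteMeasure
  rw [← FiniteMeasure.ennreal_mass, h]
  simp

/-- The transition kernel `x ↦ P_t δ_x`. -/
noncomputable def transition (t : ℝ≥0) : Kernel X X where
  toFun x := (P.op t (diracProba x).toFiniteMeasure : Measure X)
  measurable' := by
    refine Measure.measurable_of_measurable_coe _ fun A hA => ?_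
    have hm : Measurable (A.indicator fun _ => (1 : ℝ)) := measurable_const.indicator hA
    have h : ∀ x, (P.op t (diracProba x).toFiniteMeasure : Measure X) A = ENNReal.ofReal
        ((P.dual t (boundedBorel.mk hm (abs_indicator_one_le_one A)) : X → ℝ) x) := by
      intro x
      rw [dual_apply]
      change _ = ENNReal.ofReal (∫ y, A.indicator (fun _ => (1 : ℝ)) y ∂_)
      rw [integral_indicator_const _ hA]
      simp
    simp_rw [h]
    exact (P.dual t _).2.1.ennreal_ofReal

instance (t : ℝ≥0) : IsMarkovKernel (P.transition t) :=
  ⟨fun x => P.isProbabilityMeasure_op t (diracProba x)⟩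

theorem dual_eq_integral_transition (t : ℝ≥0) (f : boundedBorel X) (x : X) :
    (P.dual t f : X → ℝ) x = ∫ y, (f : X → ℝ) y ∂(P.transition t x) :=
  P.dual_apply t f x

theorem op_eq_bind (t : ℝ≥0) (μ : FiniteMeasure X) :
    (P.op t μ : Measure X) = (μ : Measure X).bind (P.transition t) := by
  ext A hA
  have hm : Measurable (A.indicator fun _ => (1 : ℝ)) := measurable_const.indicator hA
  have h := P.isDualOperator t (boundedBorel.mk hm (abs_indicator_one_le_one A)) μ
  simp_rw [dual_eq_integral_transition] at h
  rw [← integral_bind_kernel (μ : Measure X) (P.transition t)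
    (boundedBorel.mk hm (abs_indicator_one_le_one A)).2.1 (abs_indicator_one_le_one A)] at h
  change ∫ y, A.indicator (fun _ => (1 : ℝ)) y ∂_ = ∫ y, A.indicator (fun _ => (1 : ℝ)) y ∂_ at h
  rw [integral_indicator_const _ hA, integral_indicator_const _ hA] at h
  simpa [Measure.real, ENNReal.toReal_eq_toReal_iff' (measure_ne_top _ _) (measure_ne_top _ _)]
    using h

/-- The Chapman–Kolmogorov equation. -/
theorem transition_add_apply (s t : ℝ≥0) (x : X) :
    P.transition (s + t) x = (P.transition t x).bind (P.transition s) := by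
  change (P.op (s + t) _ : Measure X) = _
  rw [P.op_add, op_eq_bind]
  rfl

theorem continuous_integral_transition (t : ℝ≥0) {f : X → ℝ} {C : ℝ} (hm : Measurable f)
    (hf : Continuous f) (hC : ∀ x, |f x| ≤ C) :
    Continuous fun x => ∫ y, f y ∂(P.transition t x) := by
  have := P.feller t (boundedBorel.mk hm hC) hf
  convert this using 1
  ext x
  rw [dual_eq_integral_transition]
  rfl

theorem measurable_integral_transition (t : ℝ≥0) {f : X → ℝ} (hf : Measurable f) :
    Measurable fun x => ∫ y, f y ∂(P.transition t x) :=
  (hf.stronglyMeasurable.integral_kernel (κ := P.transition t)).measurable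

theorem integral_integral_transition (s t : ℝ≥0) {f : X → ℝ} {C : ℝ} (hf : Measurable f)
    (hC : ∀ x, |f x| ≤ C) (x : X) :
    ∫ y, ∫ w, f w ∂(P.transition s y) ∂(P.transition t x) = ∫ w, f w ∂(P.transition (s + t) x) := by
  rw [transition_add_apply, integral_bind_kernel _ _ hf hC]

end Kernel

section Average

variable {X : Type*} [MetricSpace X] [SecondCountableTopology X] [MeasurableSpace X] [BorelSpace X]
  (P : MarkovFellerSemigroup X)

/-- Closed sets form a generating π-system, and their indicators are limits of continuous functions.
For these the integral is continuous in `x` (Feller) and measurable in `s`, hence jointly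
measurable. Fubini's theorem for time and space rests on this. -/
theorem measurable_transition_uncurry :
    Measurable fun p : X × ℝ => P.transition p.2.toNNReal p.1 := by
  refine Measurable.measure_of_isPiSystem_of_isProbabilityMeasure
    (S := {s : Set X | IsClosed s})
    (by rw [BorelSpace.measurable_eq (α := X), borel_eq_generateFrom_isClosed])
    isPiSystem_isClosed fun F hF => ?_
  have h : ∀ n, Measurable fun p : X × ℝ =>
      ∫⁻ y, (hF.apprSeq n y : ℝ≥0∞) ∂(P.transition p.2.toNNReal p.1) := by
    intro n
    have hb : ∀ y, |((hF.apprSeq n y : ℝ≥0) : ℝ)| ≤ 1 := fun y => by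
      rw [abs_of_nonneg (NNReal.coe_nonneg _)]
      exact_mod_cast HasOuterApproxClosed.apprSeq_apply_le_one hF n y
    have hc : Continuous fun y => ((hF.apprSeq n y : ℝ≥0) : ℝ) :=
      NNReal.continuous_coe.comp (hF.apprSeq n).continuous
    refine measurable_uncurry_of_continuous_of_measurable (β := ℝ≥0∞)
      (u := fun (x : X) (s : ℝ) => ∫⁻ y, (hF.apprSeq n y : ℝ≥0∞) ∂(P.transition s.toNNReal x))
      (fun s => ?_) (fun x => ?_)
    · have e : ∀ x, ∫⁻ y, (hF.apprSeq n y : ℝ≥0∞) ∂(P.transition s.toNNReal x)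
          = ENNReal.ofReal (∫ y, ((hF.apprSeq n y : ℝ≥0) : ℝ) ∂(P.transition s.toNNReal x)) := by
        intro x
        rw [← BoundedContinuousFunction.toReal_lintegral_coe_eq_integral, ENNReal.ofReal_toReal]
        exact (BoundedContinuousFunction.lintegral_lt_top_of_nnreal _ _).ne
      simp_rw [e]
      exact ENNReal.continuous_ofReal.comp
        (P.continuous_integral_transition _ hc.measurable hc hb)
    · refine (Measure.measurable_lintegral
        (ENNReal.continuous_coe.comp (hF.apprSeq n).continuous).measurable).comp ?_
      exact Measure.measurable_of_measurable_coe _ fun B hB =>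
        (P.measurable_op _ B hB).comp measurable_real_toNNReal
  exact measurable_of_tendsto_metrizable h (tendsto_pi_nhds.2 fun p =>
    HasOuterApproxClosed.tendsto_lintegral_apprSeq hF _)

/-- The kernel `(x, s) ↦ P_s δ_x`. -/
noncomputable def jointTransition : Kernel (X × ℝ) X where
  toFun p := P.transition p.2.toNNReal p.1
  measurable' := P.measurable_transition_uncurry

theorem jointTransition_apply (x : X) (s : ℝ) :
    P.jointTransition (x, s) = P.transition s.toNNReal x := rfl

instance : IsMarkovKernel P.jointTransition :=
  ⟨fun p => by rw [← Prod.mk.eta (p := p), jointTransition_apply]; infer_instance⟩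

/-- The kernel `s ↦ P_s δ_x`, for a fixed `x`. -/
noncomputable def pathKernel (x : X) : Kernel ℝ X :=
  P.jointTransition.comap (fun s => (x, s)) (by fun_prop)

instance (x : X) : IsMarkovKernel (P.pathKernel x) := by
  unfold pathKernel; infer_instance

/-- The kernel `x ↦ Q_t(x, ·)`. -/
noncomputable def cesaroKernel (t : ℝ) : Kernel X X where
  toFun x := (uniformTime t).bind (P.pathKernel x)
  measurable' := by
    refine Measure.measurable_of_measurable_coe _ fun A hA => ?_
    have h : ∀ x, (uniformTime t).bind (P.pathKernel x) A
        = (ENNReal.ofReal t)⁻¹ * ∫⁻ s, P.jointTransition (x, s) A ∂(volume.restrict (Ioc 0 t)) := by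
      intro x
      rw [Measure.bind_apply hA (Kernel.aemeasurable _), uniformTime, lintegral_smul_measure]
      rfl
    simp_rw [h]
    exact ((P.jointTransition.measurable_coe hA).lintegral_prod_right').const_mul _

theorem cesaroKernel_apply (t : ℝ) (x : X) :
    P.cesaroKernel t x = (uniformTime t).bind (P.pathKernel x) := rfl

theorem cesaroMeasure_dirac (t : ℝ) (x : X) :
    P.cesaroMeasure t (diracProba x) = P.cesaroKernel t x := by
  rw [cesaroKernel_apply, uniformTime, Measure.bind_smul]
  rfl

theorem isMarkovKernel_cesaroKernel {t : ℝ} (ht : 0 < t) : IsMarkovKernel (P.cesaroKernel t) := by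
  have := isProbabilityMeasure_uniformTime ht
  refine ⟨fun x => ⟨?_⟩⟩
  rw [cesaroKernel_apply, Measure.bind_apply .univ (Kernel.aemeasurable _)]
  simp

theorem cesaroMeasure_eq_bind (t : ℝ) (ν : ProbabilityMeasure X) :
    P.cesaroMeasure t ν = (ν : Measure X).bind (P.cesaroKernel t) := by
  ext A hA
  rw [cesaroMeasure_apply _ _ _ hA, Measure.bind_apply hA (Kernel.aemeasurable _)]
  have h : ∀ x, P.cesaroKernel t x A
      = (ENNReal.ofReal t)⁻¹ * ∫⁻ s, P.jointTransition (x, s) A ∂(volume.restrict (Ioc 0 t)) := by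
    intro x
    rw [cesaroKernel_apply, Measure.bind_apply hA (Kernel.aemeasurable _), uniformTime,
      lintegral_smul_measure]
    rfl
  simp_rw [h]
  rw [lintegral_const_mul _ (P.jointTransition.measurable_coe hA).lintegral_prod_right',
    lintegral_lintegral_swap (P.jointTransition.measurable_coe hA).aemeasurable]
  congr 1
  refine lintegral_congr fun s => ?_
  rw [op_eq_bind, Measure.bind_apply hA (Kernel.aemeasurable _)]
  rfl

/-- `⟨f, Q_t(x, ·)⟩` is the time average of `P_s f (x)`. -/
theorem integral_cesaroKernel {t : ℝ} (ht : 0 < t) {f : X → ℝ} {C : ℝ} (hf : Measurable f)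
    (hC : ∀ x, |f x| ≤ C) (x : X) :
    ∫ y, f y ∂(P.cesaroKernel t x)
      = ∫ s, ∫ y, f y ∂(P.transition s.toNNReal x) ∂(uniformTime t) := by
  have := isProbabilityMeasure_uniformTime ht
  rw [cesaroKernel_apply, integral_bind_kernel _ _ hf hC]
  rfl

theorem cesaroFun_eq_integral {t : ℝ} (ht : 0 < t) (f : boundedBorel X) (x : X) :
    P.cesaroFun t f x = ∫ y, (f : X → ℝ) y ∂(P.cesaroKernel t x) := by
  obtain ⟨C, hC⟩ := f.2.2
  rw [P.integral_cesaroKernel ht f.2.1 hC, integral_uniformTime ht, cesaroFun]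
  simp_rw [dual_eq_integral_transition]

theorem measurable_integral_transition_uncurry {f : X → ℝ} (hf : Measurable f) :
    Measurable fun p : X × ℝ => ∫ y, f y ∂(P.transition p.2.toNNReal p.1) :=
  (hf.stronglyMeasurable.integral_kernel (κ := P.jointTransition)).measurable

theorem measurable_integral_transition_time {f : X → ℝ} (hf : Measurable f) (x : X) :
    Measurable fun s : ℝ => ∫ y, f y ∂(P.transition s.toNNReal x) :=
  (P.measurable_integral_transition_uncurry hf).comp (measurable_const.prodMk measurable_id)

theorem measurable_integral_cesaroKernel (t : ℝ) {f : X → ℝ} (hf : Measurable f) :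
    Measurable fun x => ∫ y, f y ∂(P.cesaroKernel t x) :=
  (hf.stronglyMeasurable.integral_kernel (κ := P.cesaroKernel t)).measurable

/-- Fubini's theorem for the time average and a probability measure on the state space. -/
theorem integral_integral_cesaroKernel (m : Measure X) [IsProbabilityMeasure m] {t : ℝ}
    (ht : 0 < t) {f : X → ℝ} {C : ℝ} (hf : Measurable f) (hC : ∀ x, |f x| ≤ C) :
    ∫ x, ∫ y, f y ∂(P.cesaroKernel t x) ∂m
      = ∫ s, ∫ x, ∫ y, f y ∂(P.transition s.toNNReal x) ∂m ∂(uniformTime t) := by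
  have := isProbabilityMeasure_uniformTime ht
  simp_rw [P.integral_cesaroKernel ht hf hC]
  refine integral_integral_swap ?_
  exact integrable_of_abs_le _ (P.measurable_integral_transition_uncurry hf)
    fun p => abs_integral_le_of_abs_le _ hC

theorem continuous_integral_cesaroKernel {t : ℝ} (ht : 0 < t) {f : X → ℝ} {C : ℝ}
    (hf : Continuous f) (hC : ∀ x, |f x| ≤ C) :
    Continuous fun x => ∫ y, f y ∂(P.cesaroKernel t x) := by
  have := isProbabilityMeasure_uniformTime ht
  simp_rw [P.integral_cesaroKernel ht hf.measurable hC]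
  refine continuous_of_dominated (bound := fun _ => C)
    (fun x => (P.measurable_integral_transition_time hf.measurable x).aestronglyMeasurable)
    (fun x => Eventually.of_forall fun s => abs_integral_le_of_abs_le _ hC)
    (integrable_const _)
    (Eventually.of_forall fun s => P.continuous_integral_transition _ hf.measurable hf hC)

section Commutation

variable {f : X → ℝ} {C : ℝ}

/-- By Chapman–Kolmogorov, composing `P_v` and `Q_t` in either order only shifts the time window by
`v`. -/
theorem integral_transition_cesaroKernel {t : ℝ} (ht : 0 < t) (v : ℝ≥0)
    (hf : Measurable f) (hC : ∀ x, |f x| ≤ C) (x : X) :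
    ∫ y, ∫ w, f w ∂(P.transition v y) ∂(P.cesaroKernel t x)
      = ∫ s, ∫ w, f w ∂(P.transition (s + v).toNNReal x) ∂(uniformTime t) := by
  rw [P.integral_cesaroKernel ht (P.measurable_integral_transition v hf)
    (fun y => abs_integral_le_of_abs_le _ hC)]
  refine integral_congr_ae ?_
  filter_upwards [ae_mem_uniformTime t] with s hs
  rw [P.integral_integral_transition _ _ hf hC, Real.toNNReal_add hs.1.le v.coe_nonneg, add_comm]
  simp

theorem integral_cesaroKernel_transition {t : ℝ} (ht : 0 < t) (v : ℝ≥0)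
    (hf : Measurable f) (hC : ∀ x, |f x| ≤ C) (x : X) :
    ∫ y, ∫ w, f w ∂(P.cesaroKernel t y) ∂(P.transition v x)
      = ∫ s, ∫ w, f w ∂(P.transition (s + v).toNNReal x) ∂(uniformTime t) := by
  rw [P.integral_integral_cesaroKernel _ ht hf hC]
  refine integral_congr_ae ?_
  filter_upwards [ae_mem_uniformTime t] with s hs
  rw [P.integral_integral_transition _ _ hf hC, Real.toNNReal_add hs.1.le v.coe_nonneg]
  simp

theorem abs_integral_transition_cesaroKernel_sub_le {t : ℝ} (ht : 0 < t) (v : ℝ≥0)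
    (hf : Measurable f) (hC : ∀ x, |f x| ≤ C) (x : X) :
    |∫ y, ∫ w, f w ∂(P.transition v y) ∂(P.cesaroKernel t x) - ∫ y, f y ∂(P.cesaroKernel t x)|
      ≤ 2 * C * v / t := by
  rw [P.integral_transition_cesaroKernel ht v hf hC, P.integral_cesaroKernel ht hf hC]
  exact abs_integral_uniformTime_shift_sub_le (P.measurable_integral_transition_time hf x)
    (fun s => abs_integral_le_of_abs_le _ hC) ht v.2

theorem abs_integral_cesaroKernel_transition_sub_le {t : ℝ} (ht : 0 < t) (v : ℝ≥0)
    (hf : Measurable f) (hC : ∀ x, |f x| ≤ C) (x : X) :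
    |∫ y, ∫ w, f w ∂(P.cesaroKernel t y) ∂(P.transition v x) - ∫ y, f y ∂(P.cesaroKernel t x)|
      ≤ 2 * C * v / t := by
  rw [P.integral_cesaroKernel_transition ht v hf hC, P.integral_cesaroKernel ht hf hC]
  exact abs_integral_uniformTime_shift_sub_le (P.measurable_integral_transition_time hf x)
    (fun s => abs_integral_le_of_abs_le _ hC) ht v.2

theorem abs_integral_uniformTime_sub_le {G : ℝ → ℝ} {C' b D r : ℝ} (hr : 0 < r)
    (hG : Measurable G) (hC' : ∀ s, |G s| ≤ C') (h : ∀ s ∈ Ioc 0 r, |G s - b| ≤ D) :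
    |∫ s, G s ∂(uniformTime r) - b| ≤ D := by
  have := isProbabilityMeasure_uniformTime hr
  have e : ∫ s, G s ∂(uniformTime r) - b = ∫ s, (G s - b) ∂(uniformTime r) := by
    rw [integral_sub (integrable_of_abs_le _ hG hC') (integrable_const _)]
    simp
  rw [e]
  simpa using norm_integral_le_of_norm_le_const (μ := uniformTime r) (f := fun s => G s - b)
    (C := D) ((ae_mem_uniformTime r).mono h)

theorem mul_div_le_of_mem_Ioc {t r s : ℝ} (ht : 0 < t) (hC : 0 ≤ C) (hs : s ∈ Ioc 0 r) :
    2 * C * (s.toNNReal : ℝ) / t ≤ 2 * C * r / t := by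
  rw [Real.coe_toNNReal _ hs.1.le]
  have := hs.2
  gcongr

/-- The bound for a shift by `s` is averaged over `s ∈ (0, r]`. This order, `Q_r f` integrated
against `Q_t(x, ·)`, transfers recurrence at large times `t`; the opposite order in the primed
version makes the oscillation subharmonic. -/
theorem abs_integral_cesaroKernel_comp_sub_le {t r : ℝ} (ht : 0 < t) (hr : 0 < r)
    (hf : Measurable f) (hC : ∀ x, |f x| ≤ C) (x : X) :
    |∫ y, ∫ w, f w ∂(P.cesaroKernel r y) ∂(P.cesaroKernel t x) - ∫ y, f y ∂(P.cesaroKernel t x)|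
      ≤ 2 * C * r / t := by
  have := P.isMarkovKernel_cesaroKernel ht
  rw [P.integral_integral_cesaroKernel _ hr hf hC]
  refine abs_integral_uniformTime_sub_le (C' := C) hr ?_ ?_ ?_
  · exact (StronglyMeasurable.integral_prod_right'
      (((P.measurable_integral_transition_uncurry hf).comp
        measurable_swap).stronglyMeasurable)).measurable
  · exact fun s => abs_integral_le_of_abs_le _ fun y => abs_integral_le_of_abs_le _ hC
  · exact fun s hs => (P.abs_integral_transition_cesaroKernel_sub_le ht _ hf hC x).trans
      (mul_div_le_of_mem_Ioc ht ((abs_nonneg _).trans (hC x)) hs)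

theorem abs_integral_cesaroKernel_comp_sub_le' {t r : ℝ} (ht : 0 < t) (hr : 0 < r)
    (hf : Measurable f) (hC : ∀ x, |f x| ≤ C) (x : X) :
    |∫ y, ∫ w, f w ∂(P.cesaroKernel t y) ∂(P.cesaroKernel r x) - ∫ y, f y ∂(P.cesaroKernel t x)|
      ≤ 2 * C * r / t := by
  have := P.isMarkovKernel_cesaroKernel ht
  rw [P.integral_cesaroKernel hr (P.measurable_integral_cesaroKernel t hf)
    (fun y => abs_integral_le_of_abs_le _ hC)]
  refine abs_integral_uniformTime_sub_le (C' := C) hr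
    (P.measurable_integral_transition_time (P.measurable_integral_cesaroKernel t hf) x) ?_ ?_
  · exact fun s => abs_integral_le_of_abs_le _ fun y => abs_integral_le_of_abs_le _ hC
  · exact fun s hs => (P.abs_integral_cesaroKernel_transition_sub_le ht _ hf hC x).trans
      (mul_div_le_of_mem_Ioc ht ((abs_nonneg _).trans (hC x)) hs)

end Commutation

end Average

end MarkovFellerSemigroup

/-! ### Invariant measures as limit points. -/

namespace MarkovFellerSemigroup

variable {X : Type*} [MetricSpace X] [SecondCountableTopology X] [MeasurableSpace X] [BorelSpace X]
  (P : MarkovFellerSemigroup X)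

/-- The probability measure `Q_t(x, ·)` for `t ≥ 1`, extended by `Q_1(x, ·)` to `t < 1`. -/
noncomputable def cesaroProba (x : X) (t : ℝ) : ProbabilityMeasure X :=
  ⟨P.cesaroKernel (max t 1) x,
    (P.isMarkovKernel_cesaroKernel (lt_max_of_lt_right one_pos)).isProbabilityMeasure x⟩

theorem coe_cesaroProba (x : X) (t : ℝ) :
    (P.cesaroProba x t : Measure X) = P.cesaroKernel (max t 1) x := rfl

omit [SecondCountableTopology X] [BorelSpace X] in
theorem isInvariant_iff_bind_eq (μ : ProbabilityMeasure X) :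
    P.IsInvariant μ ↔ ∀ t, (μ : Measure X).bind (P.transition t) = μ := by
  refine forall_congr' fun t => ?_
  rw [← FiniteMeasure.toMeasure_injective.eq_iff, op_eq_bind]
  rfl

omit [SecondCountableTopology X] [BorelSpace X] in
theorem IsInvariant.cesaroMeasure_eq {P : MarkovFellerSemigroup X} {μ : ProbabilityMeasure X}
    (hμ : P.IsInvariant μ) {t : ℝ} (ht : 0 < t) : P.cesaroMeasure t μ = μ := by
  ext A hA
  rw [cesaroMeasure_apply _ _ _ hA]
  simp_rw [hμ _]
  simp only [ProbabilityMeasure.toMeasure_comp_toFiniteMeasure_eq_toMeasure, lintegral_const,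
    Measure.restrict_apply_univ, Real.volume_Ioc, sub_zero]
  rw [mul_comm ((μ : Measure X) A), ← mul_assoc,
    ENNReal.inv_mul_cancel (by simpa using ht) ENNReal.ofReal_ne_top, one_mul]

theorem IsInvariant.bind_cesaroKernel {P : MarkovFellerSemigroup X} {μ : ProbabilityMeasure X}
    (hμ : P.IsInvariant μ) {t : ℝ} (ht : 0 < t) :
    (μ : Measure X).bind (P.cesaroKernel t) = μ := by
  rw [← cesaroMeasure_eq_bind, hμ.cesaroMeasure_eq ht]

/-- **Krylov–Bogoliubov**: every weak limit point of `Q_t(x, ·)` as `t → ∞` is invariant. -/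
theorem isInvariant_of_mapClusterPt {x : X} {μ : ProbabilityMeasure X}
    (h : MapClusterPt μ atTop (P.cesaroProba x)) : P.IsInvariant μ := by
  obtain ⟨U, hU, hlim⟩ := mapClusterPt_iff_ultrafilter.1 h
  rw [isInvariant_iff_bind_eq]
  intro v
  refine ext_of_forall_integral_eq_of_IsFiniteMeasure fun f => ?_
  have hm : Measurable f := f.continuous.measurable
  have hC : ∀ y, |f y| ≤ ‖f‖ := f.norm_coe_le_norm
  rw [integral_bind_kernel _ _ hm hC]
  -- `g = P_v f` is an admissible test function by the Feller property. Along `U` the difference `⟨g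
  -- - f, Q_t(x, ·)⟩` tends to `⟨P_v f, μ⟩ - ⟨f, μ⟩`, while it is `O(v/t)`.
  let g : BoundedContinuousFunction X ℝ := BoundedContinuousFunction.ofNormedAddCommGroup
    (fun y => ∫ w, f w ∂(P.transition v y))
    (P.continuous_integral_transition v hm f.continuous hC) ‖f‖
    (fun y => abs_integral_le_of_abs_le _ hC)
  have h1 := ((ProbabilityMeasure.continuous_integral_boundedContinuousFunction g).tendsto μ).comp
    hlim
  have h2 := ((ProbabilityMeasure.continuous_integral_boundedContinuousFunction f).tendsto μ).comp
    hlim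
  have h3 := h1.sub h2
  have h4 : Tendsto (fun t : ℝ => 2 * ‖f‖ * v / max t 1) atTop (𝓝 0) :=
    Tendsto.div_atTop tendsto_const_nhds (tendsto_atTop_mono (fun t => le_max_left t 1) tendsto_id)
  have h5 : Tendsto (fun t : ℝ => (∫ y, g y ∂(P.cesaroProba x t : Measure X))
      - ∫ y, f y ∂(P.cesaroProba x t : Measure X)) atTop (𝓝 0) :=
    squeeze_zero_norm (fun t => P.abs_integral_transition_cesaroKernel_sub_le
      (lt_max_of_lt_right one_pos) v hm hC x) h4
  exact sub_eq_zero.1 (tendsto_nhds_unique h3 (h5.mono_left hU))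

theorem isCompact_closure_range_cesaroProba {x : X}
    (h : IsTightMeasureSet {m | ∃ t : ℝ, 1 ≤ t ∧ m = P.cesaroKernel t x}) :
    IsCompact (closure (range (P.cesaroProba x))) := by
  refine isCompact_closure_of_isTightMeasureSet (h.subset ?_)
  rintro _ ⟨_, ⟨t, rfl⟩, rfl⟩
  exact ⟨max t 1, le_max_right _ _, rfl⟩

theorem exists_isInvariant_of_isTightMeasureSet {x : X}
    (h : IsTightMeasureSet {m | ∃ t : ℝ, 1 ≤ t ∧ m = P.cesaroKernel t x}) :
    ∃ μ : ProbabilityMeasure X, P.IsInvariant μ := by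
  obtain ⟨μ, -, hμ⟩ := (P.isCompact_closure_range_cesaroProba h).exists_mapClusterPt_of_frequently
    (l := atTop) (Frequently.of_forall fun t => subset_closure (mem_range_self t))
  exact ⟨μ, P.isInvariant_of_mapClusterPt hμ⟩

theorem tendsto_cesaroProba_of_unique {x : X} {μ : ProbabilityMeasure X}
    (h : IsTightMeasureSet {m | ∃ t : ℝ, 1 ≤ t ∧ m = P.cesaroKernel t x})
    (hμ : ∀ μ', P.IsInvariant μ' → μ' = μ) : Tendsto (P.cesaroProba x) atTop (𝓝 μ) :=
  (P.isCompact_closure_range_cesaroProba h).tendsto_nhds_of_unique_mapClusterPt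
    (Eventually.of_forall fun t => subset_closure (mem_range_self t))
    fun μ' _ hμ' => hμ μ' (P.isInvariant_of_mapClusterPt hμ')

end MarkovFellerSemigroup

/-! ### Maximal inequality and tightness at almost every point. -/

/-- **Hopf's maximal ergodic inequality** for a Markov kernel with an invariant probability
measure, in terms of the ergodic sums `S n`. -/
theorem setIntegral_nonneg_of_ergodic_sums {α : Type*} [MeasurableSpace α] {κ : Kernel α α}
    [IsMarkovKernel κ] {μ : Measure α} [IsProbabilityMeasure μ] (hμ : μ.bind κ = μ)
    {S : ℕ → α → ℝ} {C : ℕ → ℝ} (hS : ∀ n, Measurable (S n)) (hC : ∀ n x, |S n x| ≤ C n)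
    (h0 : ∀ x, S 0 x = 0) (hs : ∀ n x, S (n + 1) x = S 1 x + ∫ y, S n y ∂(κ x)) (n : ℕ) :
    0 ≤ ∫ x in {x | ∃ k ≤ n, 0 < S k x}, S 1 x ∂μ := by
  let M : α → ℝ := fun x => partialSups (fun k => S k x) n
  have hSM : ∀ k ≤ n, ∀ x, S k x ≤ M x := fun k hk x =>
    le_partialSups_of_le (fun k => S k x) hk
  have hMS : ∀ x, ∃ k ≤ n, M x = S k x := fun x => exists_partialSups_eq (fun k => S k x) n
  have hMm : Measurable M := by
    have : ∀ m, Measurable fun x => partialSups (fun k => S k x) m := by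
      intro m
      induction m with
      | zero => simpa using hS 0
      | succ m ih =>
        have e : (fun x => partialSups (fun k => S k x) (m + 1))
            = fun x => partialSups (fun k => S k x) m ⊔ S (m + 1) x := by
          ext x
          exact partialSups_succ (fun k => S k x) m
        rw [e]
        exact ih.sup (hS _)
    exact this n
  have hM0 : ∀ x, 0 ≤ M x := fun x => (h0 x).symm.trans_le (hSM 0 n.zero_le x)
  have hMC : ∀ x, |M x| ≤ ∑ k ∈ Finset.range (n + 1), C k := by
    intro x
    obtain ⟨k, hk, e⟩ := hMS x
    rw [e]
    exact (hC k x).trans (Finset.single_le_sum (f := C)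
      (fun i _ => (abs_nonneg _).trans (hC i x)) (Finset.mem_range.2 (by lia)))
  have hA : MeasurableSet {x | ∃ k ≤ n, 0 < S k x} := by
    have e : {x | ∃ k ≤ n, 0 < S k x} = ⋃ k, ⋃ (_ : k ≤ n), {x | 0 < S k x} := by
      ext x; simp
    rw [e]
    exact MeasurableSet.iUnion fun k => MeasurableSet.iUnion fun _ =>
      measurableSet_lt measurable_const (hS k)
  have hKm : Measurable fun x => ∫ y, M y ∂(κ x) :=
    (hMm.stronglyMeasurable.integral_kernel (κ := κ)).measurable
  have hKC : ∀ x, |∫ y, M y ∂(κ x)| ≤ ∑ k ∈ Finset.range (n + 1), C k := fun x =>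
    abs_integral_le_of_abs_le _ hMC
  -- Garsia's argument: where some `S k` is positive, the maximum `M` is attained at an index `m +
  -- 1`, so `M = S 1 + κ (S m) ≤ S 1 + κ M`; elsewhere `M ≤ 0 ≤ κ M`. By invariance `M - κ M` has
  -- integral zero.
  have key : ∀ x, M x - ∫ y, M y ∂(κ x) ≤ {x | ∃ k ≤ n, 0 < S k x}.indicator (S 1) x := by
    intro x
    by_cases hx : x ∈ {x | ∃ k ≤ n, 0 < S k x}
    · rw [indicator_of_mem hx]
      obtain ⟨j, hj, hjp⟩ := hx
      obtain ⟨k, hk, e⟩ := hMS x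
      have hk0 : k ≠ 0 := by
        rintro rfl
        have := hSM j hj x
        rw [h0] at e
        linarith
      obtain ⟨m, rfl⟩ := Nat.exists_eq_succ_of_ne_zero hk0
      have h1 : ∫ y, S m y ∂(κ x) ≤ ∫ y, M y ∂(κ x) :=
        integral_mono (integrable_of_abs_le _ (hS m) (hC m)) (integrable_of_abs_le _ hMm hMC)
          (hSM m (by lia))
      rw [e, hs]
      linarith
    · rw [indicator_of_notMem hx]
      obtain ⟨k, hk, e⟩ := hMS x
      have h1 : M x ≤ 0 := by
        rw [e]
        by_contra hc
        exact hx ⟨k, hk, not_le.1 hc⟩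
      have h2 : 0 ≤ ∫ y, M y ∂(κ x) := integral_nonneg hM0
      linarith
  rw [← integral_indicator hA]
  calc (0 : ℝ) = ∫ x, (M x - ∫ y, M y ∂(κ x)) ∂μ := by
        rw [integral_sub (integrable_of_abs_le _ hMm hMC) (integrable_of_abs_le _ hKm hKC),
          ← integral_bind_kernel μ κ hMm hMC, hμ, sub_self]
    _ ≤ _ := integral_mono
        ((integrable_of_abs_le _ hMm hMC).sub (integrable_of_abs_le _ hKm hKC))
        ((integrable_of_abs_le _ (hS 1) (hC 1)).indicator hA) key

namespace MarkovFellerSemigroup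

variable {X : Type*} [MetricSpace X] [SecondCountableTopology X] [MeasurableSpace X] [BorelSpace X]
  (P : MarkovFellerSemigroup X)

theorem integral_cesaroKernel_eq_intervalIntegral {t : ℝ} (ht : 0 < t) {f : X → ℝ} {C : ℝ}
    (hf : Measurable f) (hC : ∀ x, |f x| ≤ C) (x : X) :
    ∫ y, f y ∂(P.cesaroKernel t x)
      = t⁻¹ * ∫ s in (0 : ℝ)..t, ∫ y, f y ∂(P.transition s.toNNReal x) := by
  rw [P.integral_cesaroKernel ht hf hC, integral_uniformTime ht]

theorem intervalIntegrable_integral_transition {f : X → ℝ} {C : ℝ}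
    (hf : Measurable f) (hC : ∀ x, |f x| ≤ C) (x : X) (a b : ℝ) :
    IntervalIntegrable (fun s : ℝ => ∫ y, f y ∂(P.transition s.toNNReal x)) volume a b :=
  (intervalIntegrable_const (c := C)).mono_fun
    (P.measurable_integral_transition_time hf x).aestronglyMeasurable
    (Eventually.of_forall fun _ => (abs_integral_le_of_abs_le _ hC).trans (le_abs_self C))

/-- Splitting the time integral at `h` exhibits `k Q_{kh} f` as the ergodic sums of `Q_h f` for the
single kernel `P_h`. -/
theorem succ_mul_integral_cesaroKernel {h : ℝ} (hh : 0 < h) {f : X → ℝ} {C : ℝ}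
    (hf : Measurable f) (hC : ∀ x, |f x| ≤ C) (x : X) (k : ℕ) :
    ((k + 1 : ℕ) : ℝ) * ∫ y, f y ∂(P.cesaroKernel ((k + 1 : ℕ) * h) x)
      = ∫ y, f y ∂(P.cesaroKernel h x)
        + k * ∫ y, ∫ w, f w ∂(P.cesaroKernel (k * h) y) ∂(P.transition h.toNNReal x) := by
  rcases Nat.eq_zero_or_pos k with rfl | hk
  · simp
  have hk' : (0 : ℝ) < k := by exact_mod_cast hk
  have hi := P.intervalIntegrable_integral_transition hf hC x
  rw [P.integral_cesaroKernel_transition (by positivity) _ hf hC,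
    P.integral_cesaroKernel_eq_intervalIntegral (by positivity) hf hC,
    P.integral_cesaroKernel_eq_intervalIntegral hh hf hC, integral_uniformTime (by positivity),
    Real.coe_toNNReal _ hh.le,
    intervalIntegral.integral_comp_add_right
      (fun s : ℝ => ∫ w, f w ∂(P.transition s.toNNReal x)) h]
  have e : (k : ℝ) * h + h = ((k + 1 : ℕ) : ℝ) * h := by push_cast; ring
  rw [zero_add, e, ← intervalIntegral.integral_add_adjacent_intervals (hi 0 h) (hi h _)]
  have : ((k + 1 : ℕ) : ℝ) ≠ 0 := by positivity
  field_simp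

/-- The maximal inequality for time averages over the multiples of a fixed time. -/
theorem measure_exists_nat_mul_lt_le {μ : ProbabilityMeasure X} (hμ : P.IsInvariant μ)
    {f : X → ℝ} (hf : Measurable f) (hf0 : ∀ x, 0 ≤ f x) (hf1 : ∀ x, f x ≤ 1) {l : ℝ} (hl : 0 < l)
    {h : ℝ} (hh : 0 < h) :
    (μ : Measure X) {x | ∃ k : ℕ, 0 < k ∧ l < ∫ y, f y ∂(P.cesaroKernel (k * h) x)}
      ≤ ENNReal.ofReal ((∫ x, f x ∂(μ : Measure X)) / l) := by
  have hC : ∀ x, |f x| ≤ 1 := fun x => by rw [abs_of_nonneg (hf0 x)]; exact hf1 x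
  -- These are the ergodic sums of `Q_h f - l` under `P_h`; the factor `k` makes the meaningless
  -- average at time zero harmless.
  let S : ℕ → X → ℝ := fun k x => k * (∫ y, f y ∂(P.cesaroKernel (k * h) x) - l)
  have hQC : ∀ (k : ℕ) x, |(k : ℝ) * ∫ y, f y ∂(P.cesaroKernel (k * h) x)| ≤ k := by
    intro k x
    rcases Nat.eq_zero_or_pos k with rfl | hk
    · simp
    have := P.isMarkovKernel_cesaroKernel (t := k * h) (by positivity)
    rw [abs_mul, Nat.abs_cast]
    exact mul_le_of_le_one_right (Nat.cast_nonneg k) (abs_integral_le_of_abs_le _ hC)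
  have hQm : ∀ k : ℕ, Measurable fun x => (k : ℝ) * ∫ y, f y ∂(P.cesaroKernel (k * h) x) :=
    fun k => (P.measurable_integral_cesaroKernel _ hf).const_mul _
  have hS : ∀ k, Measurable (S k) := fun k =>
    ((P.measurable_integral_cesaroKernel _ hf).sub_const l).const_mul _
  have hSC : ∀ k x, |S k x| ≤ k + k * l := by
    intro k x
    have e : S k x = (k : ℝ) * ∫ y, f y ∂(P.cesaroKernel (k * h) x) - k * l := mul_sub _ _ _
    rw [e]
    refine (abs_sub _ _).trans (add_le_add (hQC k x) (abs_of_nonneg (by positivity)).le)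
  have hrec : ∀ k x, S (k + 1) x = S 1 x + ∫ y, S k y ∂(P.transition h.toNNReal x) := by
    intro k x
    have e : ∫ y, S k y ∂(P.transition h.toNNReal x)
        = k * ∫ y, ∫ w, f w ∂(P.cesaroKernel (k * h) y) ∂(P.transition h.toNNReal x) - k * l := by
      simp only [S, mul_sub]
      rw [integral_sub (integrable_of_abs_le _ (hQm k) (hQC k)) (integrable_const _),
        integral_const_mul]
      simp
    have e1 := P.succ_mul_integral_cesaroKernel hh hf hC x k
    rw [e]
    simp only [S, mul_sub]
    rw [e1]
    push_cast
    simp only [one_mul]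
    ring
  have hbd : ∀ n : ℕ, (μ : Measure X) {x | ∃ k ≤ n, 0 < S k x}
      ≤ ENNReal.ofReal ((∫ x, f x ∂(μ : Measure X)) / l) := by
    intro n
    have h1 := setIntegral_nonneg_of_ergodic_sums ((P.isInvariant_iff_bind_eq μ).1 hμ h.toNNReal)
      hS hSC (fun x => by simp [S]) hrec n
    set A := {x | ∃ k ≤ n, 0 < S k x}
    have := P.isMarkovKernel_cesaroKernel hh
    have e : ∀ x, S 1 x = ∫ y, f y ∂(P.cesaroKernel h x) - l := fun x => by simp [S]
    have hm := P.measurable_integral_cesaroKernel h hf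
    have hb : ∀ x, |∫ y, f y ∂(P.cesaroKernel h x)| ≤ 1 := fun x => abs_integral_le_of_abs_le _ hC
    simp_rw [e] at h1
    rw [integral_sub (integrable_of_abs_le _ hm hb) (integrable_const _), integral_const,
      measureReal_restrict_apply_univ, smul_eq_mul, sub_nonneg] at h1
    have h2 : ∫ x in A, ∫ y, f y ∂(P.cesaroKernel h x) ∂(μ : Measure X)
        ≤ ∫ x, f x ∂(μ : Measure X) := by
      calc _ ≤ ∫ x, ∫ y, f y ∂(P.cesaroKernel h x) ∂(μ : Measure X) :=
            setIntegral_le_integral (integrable_of_abs_le _ hm hb)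
              (Eventually.of_forall fun x => integral_nonneg hf0)
        _ = _ := by
            rw [← integral_bind_kernel (μ : Measure X) (P.cesaroKernel h) hf hC,
              hμ.bind_cesaroKernel hh]
    rw [← ofReal_measureReal]
    refine ENNReal.ofReal_le_ofReal ?_
    rw [le_div_iff₀ hl]
    exact h1.trans h2
  have hU : {x | ∃ k : ℕ, 0 < k ∧ l < ∫ y, f y ∂(P.cesaroKernel (k * h) x)}
      ⊆ ⋃ n : ℕ, {x | ∃ k ≤ n, 0 < S k x} := by
    rintro x ⟨k, hk, hx⟩
    exact mem_iUnion.2 ⟨k, k, le_rfl, mul_pos (by exact_mod_cast hk) (sub_pos.2 hx)⟩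
  refine (measure_mono hU).trans ?_
  rw [Monotone.measure_iUnion]
  · exact iSup_le hbd
  · rintro a b hab x ⟨k, hk, hx⟩
    exact ⟨k, hk.trans hab, hx⟩

theorem continuousAt_integral_cesaroKernel {f : X → ℝ} {C : ℝ} (hf : Measurable f)
    (hC : ∀ x, |f x| ≤ C) (x : X) {t : ℝ} (ht : 0 < t) :
    ContinuousAt (fun t => ∫ y, f y ∂(P.cesaroKernel t x)) t := by
  have h : ContinuousAt (fun t : ℝ =>
      t⁻¹ * ∫ s in (0 : ℝ)..t, ∫ y, f y ∂(P.transition s.toNNReal x)) t :=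
    (continuousAt_inv₀ ht.ne').mul (intervalIntegral.continuous_primitive
      (P.intervalIntegrable_integral_transition hf hC x) 0).continuousAt
  refine h.congr ?_
  filter_upwards [lt_mem_nhds ht] with s hs
  exact (P.integral_cesaroKernel_eq_intervalIntegral hs hf hC x).symm

/-- The maximal inequality for time averages over all positive times. -/
theorem measure_exists_lt_integral_cesaroKernel_le {μ : ProbabilityMeasure X}
    (hμ : P.IsInvariant μ) {f : X → ℝ} (hf : Measurable f) (hf0 : ∀ x, 0 ≤ f x)
    (hf1 : ∀ x, f x ≤ 1) {l : ℝ} (hl : 0 < l) :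
    (μ : Measure X) {x | ∃ t : ℝ, 0 < t ∧ l < ∫ y, f y ∂(P.cesaroKernel t x)}
      ≤ ENNReal.ofReal ((∫ x, f x ∂(μ : Measure X)) / l) := by
  have hC : ∀ x, |f x| ≤ 1 := fun x => by rw [abs_of_nonneg (hf0 x)]; exact hf1 x
  -- The dyadic grids are nested, so `A` is increasing. Since `Q_t f(x)` is continuous in `t > 0`, a
  -- strict inequality at `t` persists at a nearby dyadic time.
  let A : ℕ → Set X := fun j =>
    {x | ∃ k : ℕ, 0 < k ∧ l < ∫ y, f y ∂(P.cesaroKernel (k * ((2 : ℝ) ^ j)⁻¹) x)}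
  have hU : {x | ∃ t : ℝ, 0 < t ∧ l < ∫ y, f y ∂(P.cesaroKernel t x)} ⊆ ⋃ j, A j := by
    rintro x ⟨t, ht, hx⟩
    have h1 : Tendsto (fun j : ℕ => (⌈t * (2 : ℝ) ^ j⌉₊ : ℝ) / (2 : ℝ) ^ j) atTop (𝓝 t) :=
      (tendsto_nat_ceil_mul_div_atTop ht.le).comp
        (tendsto_pow_atTop_atTop_of_one_lt (one_lt_two : (1 : ℝ) < 2))
    have h2 := (P.continuousAt_integral_cesaroKernel hf hC x ht).tendsto.comp h1
    obtain ⟨j, hj⟩ := (h2.eventually_const_lt hx).exists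
    refine mem_iUnion.2 ⟨j, ⌈t * (2 : ℝ) ^ j⌉₊, Nat.ceil_pos.2 (by positivity), ?_⟩
    rw [← div_eq_mul_inv]
    exact hj
  refine (measure_mono hU).trans ?_
  rw [Monotone.measure_iUnion]
  · exact iSup_le fun j => P.measure_exists_nat_mul_lt_le hμ hf hf0 hf1 hl (by positivity)
  · refine monotone_nat_of_le_succ ?_
    rintro j x ⟨k, hk, hx⟩
    refine ⟨2 * k, by lia, ?_⟩
    have e : ((2 * k : ℕ) : ℝ) * ((2 : ℝ) ^ (j + 1))⁻¹ = k * ((2 : ℝ) ^ j)⁻¹ := by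
      push_cast
      field_simp
      ring
    rw [e]
    exact hx

/-- Almost every point, with respect to an invariant probability measure, has a tight family of
time averages. -/
theorem ae_mem_tightPoints [CompleteSpace X] {μ : ProbabilityMeasure X} (hμ : P.IsInvariant μ) :
    ∀ᵐ x ∂(μ : Measure X), x ∈ P.tightPoints := by
  have hK : ∀ n : ℕ, ∃ K : Set X, IsCompact K ∧
      (μ : Measure X) Kᶜ ≤ ENNReal.ofReal ((4 : ℝ)⁻¹ ^ n) := by
    intro n
    obtain ⟨K, hK, h⟩ := isTightMeasureSet_iff_exists_isCompact_measure_compl_le.1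
      (isTightMeasureSet_singleton (μ := (μ : Measure X))) (ENNReal.ofReal ((4 : ℝ)⁻¹ ^ n))
      (by simp)
    exact ⟨K, hK, h _ rfl⟩
  choose K hK hμK using hK
  let f : ℕ → X → ℝ := fun n => (K n)ᶜ.indicator fun _ => 1
  have hKm : ∀ n, MeasurableSet (K n)ᶜ := fun n => (hK n).measurableSet.compl
  have hf : ∀ n, Measurable (f n) := fun n => measurable_const.indicator (hKm n)
  have hf0 : ∀ n x, 0 ≤ f n x := fun n => indicator_nonneg fun _ _ => zero_le_one
  have hf1 : ∀ n x, f n x ≤ 1 := fun n x => (le_abs_self _).trans (abs_indicator_one_le_one _ x)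
  have hint : ∀ n (m : Measure X), ∫ x, f n x ∂m = m.real (K n)ᶜ := fun n m => by
    simp only [f]
    rw [integral_indicator_const _ (hKm n)]
    simp
  -- With mass `4⁻ⁿ` outside `K n` and threshold `2⁻ⁿ`, the maximal inequality gives `μ (A n) ≤
  -- 2⁻ⁿ`, which is summable.
  let A : ℕ → Set X := fun n =>
    {x | ∃ t : ℝ, 0 < t ∧ (2 : ℝ)⁻¹ ^ n < ∫ y, f n y ∂(P.cesaroKernel t x)}
  have hA : ∀ n, (μ : Measure X) (A n) ≤ ENNReal.ofReal ((2 : ℝ)⁻¹ ^ n) := by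
    intro n
    refine (P.measure_exists_lt_integral_cesaroKernel_le hμ (hf n) (hf0 n) (hf1 n)
      (by positivity)).trans (ENNReal.ofReal_le_ofReal ?_)
    rw [hint, div_le_iff₀ (by positivity), ← mul_pow]
    refine (ENNReal.toReal_le_of_le_ofReal (by positivity) (hμK n)).trans (le_of_eq ?_)
    norm_num
  have hsum : ∑' n, (μ : Measure X) (A n) ≠ ∞ := by
    refine ne_top_of_le_ne_top ?_ (ENNReal.tsum_le_tsum hA)
    rw [← ENNReal.ofReal_tsum_of_nonneg (fun n => by positivity)
      (summable_geometric_of_lt_one (by norm_num) (by norm_num))]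
    exact ENNReal.ofReal_ne_top
  filter_upwards [ae_eventually_notMem hsum] with x hx
  refine isTightMeasureSet_iff_exists_isCompact_measure_compl_le.2 fun ε hε => ?_
  have hlim : Tendsto (fun n : ℕ => ENNReal.ofReal ((2 : ℝ)⁻¹ ^ n)) atTop (𝓝 0) := by
    have := ENNReal.tendsto_ofReal
      (tendsto_pow_atTop_nhds_zero_of_lt_one (r := (2 : ℝ)⁻¹) (by norm_num) (by norm_num))
    simpa using this
  obtain ⟨n, hn, hnε⟩ := (hx.and (hlim.eventually_le_const hε)).exists
  refine ⟨K n, hK n, ?_⟩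
  rintro _ ⟨t, ht, rfl⟩
  have := P.isMarkovKernel_cesaroKernel ht
  rw [cesaroMeasure_dirac]
  refine le_trans ?_ hnε
  rw [← ofReal_measureReal, ← hint]
  refine ENNReal.ofReal_le_ofReal ?_
  by_contra hc
  exact hn ⟨t, ht, not_le.1 hc⟩

end MarkovFellerSemigroup

/-! ### Gliding hump, a tightness criterion and sums of separated bumps. -/

/-- One step of the gliding hump construction. -/
theorem exists_gliding_hump_step {a : ℕ → ℕ → ℝ} {c : ℝ} (hc : 0 < c)
    (h : ∃ᶠ i in atTop, c ≤ |a i i|) (F : Finset ℕ) (N : ℕ)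
    (hF : F ⊆ Finset.range N) :
    ∃ i F' N', N ≤ i ∧ i < N' ∧ F ⊆ F' ∧ F' ⊆ insert i F ∧ c / 2 ≤ |∑ l ∈ F', a i l| ∧
      ∑' l, |a i (l + N')| ≤ c / 4 := by
  obtain ⟨i, hi, hci⟩ := frequently_atTop.1 h N
  have hiF : i ∉ F := fun hm => by
    have := Finset.mem_range.1 (hF hm)
    lia
  obtain ⟨N', hN', hle⟩ : ∃ N', i < N' ∧ ∑' l, |a i (l + N')| ≤ c / 4 :=
    ((eventually_gt_atTop i).and ((tendsto_sum_nat_add fun l => |a i l|).eventually_le_const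
      (by positivity))).exists
  -- If the columns in `F` contribute less than `c / 2`, adding the new column `i`, whose entry is
  -- at least `c` in absolute value, brings the sum above `c / 2`.
  by_cases hF' : c / 2 ≤ |∑ l ∈ F, a i l|
  · exact ⟨i, F, N', hi, hN', subset_rfl, Finset.subset_insert _ _, hF', hle⟩
  · refine ⟨i, insert i F, N', hi, hN', Finset.subset_insert _ _, subset_rfl, ?_, hle⟩
    rw [Finset.sum_insert hiF]
    have := abs_sub_abs_le_abs_sub (a i i) (-∑ l ∈ F, a i l)
    rw [abs_neg, sub_neg_eq_add] at this
    linarith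

/-- **Gliding hump**: for countably many matrices with summable rows and infinitely many large
diagonal entries, the row sums over a suitable set of columns are infinitely often large for all of
the matrices at once. -/
theorem exists_set_frequently_le_abs_tsum_indicator {a : ℕ → ℕ → ℕ → ℝ}
    (hs : ∀ k i, Summable fun l => |a k i l|) {c : ℝ} (hc : 0 < c)
    (h : ∀ k, ∃ᶠ i in atTop, c ≤ |a k i i|) :
    ∃ I : Set ℕ, ∀ k, ∃ᶠ i in atTop, c / 4 ≤ |∑' l, I.indicator (a k i) l| := by
  choose idx nF nN h1 h2 h3 h4 h5 h6 using fun k => exists_gliding_hump_step hc (h k)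
  -- Stage `m` treats the matrix `m.unpair.1`, so each matrix is treated infinitely often.
  let next : ℕ → {p : Finset ℕ × ℕ // p.1 ⊆ Finset.range p.2} →
      {p : Finset ℕ × ℕ // p.1 ⊆ Finset.range p.2} := fun m p =>
    ⟨(nF m.unpair.1 p.1.1 p.1.2 p.2, nN m.unpair.1 p.1.1 p.1.2 p.2), by
      refine (h4 m.unpair.1 p.1.1 p.1.2 p.2).trans (Finset.insert_subset ?_ (p.2.trans ?_))
      · exact Finset.mem_range.2 (h2 _ _ _ _)
      · exact Finset.range_mono ((h1 _ _ _ _).trans (h2 _ _ _ _).le)⟩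
  let st : ℕ → {p : Finset ℕ × ℕ // p.1 ⊆ Finset.range p.2} := fun m =>
    Nat.rec ⟨(∅, 0), by simp⟩ next m
  let F : ℕ → Finset ℕ := fun m => (st m).1.1
  let N : ℕ → ℕ := fun m => (st m).1.2
  let ix : ℕ → ℕ := fun m => idx m.unpair.1 (F m) (N m) (st m).2
  have hNi : ∀ m, N m ≤ ix m := fun m => h1 _ _ _ _
  have hiN : ∀ m, ix m < N (m + 1) := fun m => h2 _ _ _ _
  have hFF : ∀ m, F m ⊆ F (m + 1) := fun m => h3 _ _ _ _
  have hFi : ∀ m, F (m + 1) ⊆ insert (ix m) (F m) := fun m => h4 _ _ _ _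
  have hbig : ∀ m, c / 2 ≤ |∑ l ∈ F (m + 1), a m.unpair.1 (ix m) l| := fun m => h5 _ _ _ _
  have htail : ∀ m, ∑' l, |a m.unpair.1 (ix m) (l + N (m + 1))| ≤ c / 4 := fun m => h6 _ _ _ _
  have hNmono : StrictMono N := strictMono_nat_of_lt_succ fun m => (hNi m).trans_lt (hiN m)
  have hFmono : Monotone F := monotone_nat_of_le_succ hFF
  -- Columns added later lie at or beyond `N m`. Hence in the row of stage `m` the final set `I`
  -- agrees with `F (m + 1)` up to the tail, which costs at most `c / 4` of the `c / 2`.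
  have hFN : ∀ m j l, l ∈ F (m + j) → l < N m → l ∈ F m := by
    intro m j l
    induction j with
    | zero => exact fun h _ => h
    | succ j ih =>
      intro hl hlt
      rcases Finset.mem_insert.1 (hFi _ hl) with rfl | hl
      · have := hNi (m + j)
        have := hNmono.monotone (Nat.le_add_right m j)
        lia
      · exact ih hl hlt
  refine ⟨⋃ m, (F m : Set ℕ), fun k => frequently_atTop.2 fun n => ?_⟩
  set m := Nat.pair k n
  have hm : m.unpair.1 = k := by simp [m]
  have hnm : n ≤ ix m :=
    (Nat.right_le_pair k n).trans ((hNmono.le_apply).trans (hNi m))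
  have hbig' := hbig m
  have htail' := htail m
  rw [hm] at hbig' htail'
  refine ⟨ix m, hnm, ?_⟩
  set b := a k (ix m)
  set I : Set ℕ := ⋃ m, (F m : Set ℕ)
  have hb : Summable b := (hs k (ix m)).of_abs
  have hIb : Summable (I.indicator b) := hb.indicator I
  have hfin : ∑ l ∈ Finset.range (N (m + 1)), I.indicator b l = ∑ l ∈ F (m + 1), b l := by
    have hsub : F (m + 1) ⊆ Finset.range (N (m + 1)) := (st (m + 1)).2
    rw [← Finset.sum_subset hsub]
    · refine Finset.sum_congr rfl fun l hl => indicator_of_mem ?_ _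
      exact mem_iUnion.2 ⟨m + 1, hl⟩
    · intro l hl hlF
      refine indicator_of_notMem (fun hI => hlF ?_) _
      obtain ⟨j, hj⟩ := mem_iUnion.1 hI
      exact hFN (m + 1) j l (hFmono (by lia) hj) (Finset.mem_range.1 hl)
  have hrest : |∑' l, I.indicator b (l + N (m + 1))| ≤ c / 4 := by
    refine le_trans ?_ htail'
    have hsum : Summable fun l => |b (l + N (m + 1))| :=
      (summable_nat_add_iff (f := fun l => |b l|) (N (m + 1))).2 (hs k (ix m))
    refine tsum_of_norm_bounded (f := fun l => I.indicator b (l + N (m + 1)))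
      hsum.hasSum fun l => ?_
    exact norm_indicator_le_norm_self _ _
  rw [← hIb.sum_add_tsum_nat_add (N (m + 1)), hfin]
  have := abs_sub_abs_le_abs_sub (∑ l ∈ F (m + 1), b l) (-∑' l, I.indicator b (l + N (m + 1)))
  rw [abs_neg, sub_neg_eq_add] at this
  linarith

/-- In a complete separable metric space, a family of measures is tight if, up to arbitrarily small
mass and uniformly over the family, it is carried by finitely many balls of any given radius. -/
theorem isTightMeasureSet_of_forall_exists_ball {X : Type*} [MetricSpace X] [CompleteSpace X]
    [MeasurableSpace X] {S : Set (Measure X)} {d : ℕ → X}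
    (h : ∀ r : ℝ, 0 < r → ∀ δ : ℝ≥0∞, δ ≠ 0 →
      ∃ n : ℕ, ∀ m ∈ S, m (⋃ k < n, Metric.ball (d k) r)ᶜ ≤ δ) :
    IsTightMeasureSet S := by
  refine isTightMeasureSet_iff_exists_isCompact_measure_compl_le.2 fun ε hε => ?_
  obtain ⟨δ, hδ, hδε⟩ := ENNReal.exists_pos_sum_of_countable' hε.ne' ℕ
  choose n hn using fun j : ℕ => h (1 / ((j : ℝ) + 1)) (by positivity) (δ j) (hδ j).ne'
  -- Closed balls make `K` closed; it is totally bounded, since the radii tend to zero.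
  let K : Set X := ⋂ j, ⋃ k < n j, Metric.closedBall (d k) (1 / ((j : ℝ) + 1))
  refine ⟨K, ?_, fun m hm => ?_⟩
  · refine TotallyBounded.isCompact_of_isClosed ?_ ?_
    · refine Metric.totallyBounded_iff.2 fun r hr => ?_
      obtain ⟨j, hj⟩ := exists_nat_one_div_lt hr
      refine ⟨d '' Iio (n j), (finite_Iio _).image _, ?_⟩
      rw [biUnion_image]
      refine (iInter_subset _ j).trans (iUnion₂_mono fun k _ => ?_)
      exact Metric.closedBall_subset_ball hj
    · exact isClosed_iInter fun j =>
        (finite_Iio (n j)).isClosed_biUnion fun _ _ => Metric.isClosed_closedBall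
  · rw [compl_iInter]
    refine (measure_iUnion_le _).trans ((ENNReal.tsum_le_tsum fun j => ?_).trans hδε.le)
    refine (measure_mono (compl_subset_compl.2 ?_)).trans (hn j m hm)
    exact iUnion₂_mono fun k _ => Metric.ball_subset_closedBall

/-- The sum of the thickened indicators of a subfamily of a family of sets with disjoint
thickenings is Lipschitz. -/
theorem lipschitzWith_tsum_indicator_thickenedIndicator {X : Type*} [MetricSpace X] {r : ℝ}
    (hr : 0 < r) {C : ℕ → Set X}
    (hC : Pairwise fun i j => Disjoint (Metric.thickening r (C i)) (Metric.thickening r (C j)))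
    (I : Set ℕ) :
    LipschitzWith r.toNNReal⁻¹
      fun x => ∑' l, I.indicator (fun l => ((thickenedIndicator hr (C l) x : ℝ≥0) : ℝ)) l := by
  have h0 : ∀ l, ∀ x ∉ Metric.thickening r (C l), thickenedIndicator hr (C l) x = 0 :=
    fun l x hx => thickenedIndicator_zero hr _ hx
  have h1 : ∀ x i, x ∈ Metric.thickening r (C i) →
      ∀ l, l ≠ i → I.indicator (fun l => ((thickenedIndicator hr (C l) x : ℝ≥0) : ℝ)) l = 0 := by
    intro x i hx l hl
    refine indicator_apply_eq_zero.2 fun _ => ?_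
    rw [h0 l x fun hxl => disjoint_left.1 (hC hl) hxl hx, NNReal.coe_zero]
  have hnn : ∀ x l, 0 ≤ I.indicator (fun l => ((thickenedIndicator hr (C l) x : ℝ≥0) : ℝ)) l :=
    fun x l => indicator_nonneg (fun _ _ => NNReal.coe_nonneg _) l
  have hsum : ∀ x, Summable fun l =>
      I.indicator (fun l => ((thickenedIndicator hr (C l) x : ℝ≥0) : ℝ)) l := by
    intro x
    by_cases hx : ∃ i, x ∈ Metric.thickening r (C i)
    · obtain ⟨i, hi⟩ := hx
      exact summable_of_ne_finset_zero (s := {i}) fun l hl => h1 x i hi l (by simpa using hl)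
    · push Not at hx
      exact summable_of_ne_finset_zero (s := ∅) fun l _ =>
        indicator_apply_eq_zero.2 fun _ => by rw [h0 l x (hx l), NNReal.coe_zero]
  -- A one-sided bound suffices. At most one term is nonzero at `x`; it is compared with the same
  -- term at `y`, and the other nonnegative terms at `y` are dropped, so the constant is that of a
  -- single bump.
  refine LipschitzWith.of_le_add_mul _ fun x y => ?_
  by_cases hx : ∃ i, x ∈ Metric.thickening r (C i)
  · obtain ⟨i, hi⟩ := hx
    rw [tsum_eq_single i (h1 x i hi)]
    have h2 := (hsum y).le_tsum i fun l _ => hnn y l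
    refine le_trans ?_ (add_le_add_left h2 _)
    by_cases hI : i ∈ I
    · simp only [indicator_of_mem hI]
      have h3 := (lipschitzWith_thickenedIndicator hr (C i)).dist_le_mul x y
      rw [NNReal.dist_eq] at h3
      linarith [le_abs_self (((thickenedIndicator hr (C i) x : ℝ≥0) : ℝ)
        - ((thickenedIndicator hr (C i) y : ℝ≥0) : ℝ))]
    · simp only [indicator_of_notMem hI]
      positivity
  · push Not at hx
    have : ∑' l, I.indicator (fun l => ((thickenedIndicator hr (C l) x : ℝ≥0) : ℝ)) l = 0 := by
      rw [← tsum_zero (α := ℝ) (β := ℕ)]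
      refine tsum_congr fun l => indicator_apply_eq_zero.2 fun _ => ?_
      rw [h0 l x (hx l), NNReal.coe_zero]
    rw [this]
    exact add_nonneg (tsum_nonneg (hnn y)) (by positivity)

theorem hasSum_coe_thickenedIndicator {X : Type*} [MetricSpace X] {r : ℝ}
    (hr : 0 < r) {C : ℕ → Set X}
    (hC : Pairwise fun i j => Disjoint (Metric.thickening r (C i)) (Metric.thickening r (C j)))
    (x : X) :
    ∃ b ≤ 1, HasSum (fun l => ((thickenedIndicator hr (C l) x : ℝ≥0) : ℝ)) b := by
  by_cases hx : ∃ i, x ∈ Metric.thickening r (C i)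
  · obtain ⟨i, hi⟩ := hx
    refine ⟨_, ?_, hasSum_single i fun l hl => ?_⟩
    · exact_mod_cast thickenedIndicator_le_one hr (C i) x
    · rw [thickenedIndicator_zero hr _ fun hxl => disjoint_left.1 (hC hl) hxl hi, NNReal.coe_zero]
  · push Not at hx
    refine ⟨0, zero_le_one, ?_⟩
    convert hasSum_zero (α := ℝ) (β := ℕ) with l
    rw [thickenedIndicator_zero hr _ (hx l), NNReal.coe_zero]

/-! ### Tightness of the time averages at a recurrent point. -/

namespace MarkovFellerSemigroup

variable {X : Type*} [MetricSpace X] [SecondCountableTopology X] [MeasurableSpace X] [BorelSpace X]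
  (P : MarkovFellerSemigroup X)

/-- The points all of whose neighbourhoods carry mass of the time averages started from `z`. -/
def reachable (z : X) : Set X :=
  {y | ∀ ε : ℝ, 0 < ε → ∃ s : ℝ, 0 < s ∧ 0 < P.cesaroKernel s z (Metric.ball y ε)}

/-- Closedness makes the reachable points a complete space, to which Baire's theorem applies. -/
theorem isClosed_reachable (z : X) : IsClosed (P.reachable z) := by
  refine isClosed_of_closure_subset fun y hy ε hε => ?_
  obtain ⟨y', hy', hd⟩ := Metric.mem_closure_iff.1 hy (ε / 2) (by positivity)
  obtain ⟨s, hs, hp⟩ := hy' (ε / 2) (by positivity)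
  refine ⟨s, hs, hp.trans_le (measure_mono (Metric.ball_subset_ball' ?_))⟩
  rw [dist_comm] at hd
  linarith

/-- An unreachable point has a ball null for all averages from `z`; by second countability countably
many such balls suffice. -/
theorem ae_mem_reachable (z : X) {s : ℝ} (hs : 0 < s) :
    ∀ᵐ y ∂(P.cesaroKernel s z), y ∈ P.reachable z := by
  refine measure_null_of_locally_null _ fun y hy => ?_
  have hy' : ∃ ε : ℝ, 0 < ε ∧ ∀ s : ℝ, 0 < s → P.cesaroKernel s z (Metric.ball y ε) = 0 := by
    by_contra hc
    push Not at hc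
    refine hy fun ε hε => ?_
    obtain ⟨s, hs, h⟩ := hc ε hε
    exact ⟨s, hs, pos_iff_ne_zero.2 h⟩
  obtain ⟨ε, hε, h⟩ := hy'
  exact ⟨Metric.ball y ε, mem_nhdsWithin_of_mem_nhds (Metric.ball_mem_nhds y hε), h s hs⟩

/-- The hypothesis `limsup Q_t(x, B(z, ε)) > 0`, in terms of frequent lower bounds. -/
theorem exists_frequently_le_real_of_limsup_pos {x : X} {A : Set X}
    (h : 0 < limsup (fun t : ℝ => P.cesaroMeasure t (diracProba x) A) atTop) :
    ∃ α : ℝ, 0 < α ∧ ∃ᶠ t in atTop, α ≤ (P.cesaroKernel t x).real A := by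
  obtain ⟨a, ha0, ha⟩ := exists_between h
  have ha' : a ≠ ∞ := ne_top_of_lt ha
  refine ⟨a.toReal, ENNReal.toReal_pos ha0.ne' ha', ?_⟩
  refine ((frequently_lt_of_lt_limsup (by isBoundedDefault) ha).and_eventually
    (eventually_gt_atTop 0)).mono ?_
  rintro t ⟨ht, ht0⟩
  have := P.isMarkovKernel_cesaroKernel ht0
  rw [cesaroMeasure_dirac] at ht
  exact ENNReal.toReal_mono (measure_ne_top _ _) ht.le

/-- A ball which is reached from a recurrent point is visited with positive frequency. -/
theorem exists_frequently_le_real_ball {z : X}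
    (hz : ∀ ε : ℝ, 0 < ε → ∃ α : ℝ, 0 < α ∧
      ∃ᶠ t in atTop, α ≤ (P.cesaroKernel t z).real (Metric.ball z ε))
    {y : X} (hy : y ∈ P.reachable z) {ε : ℝ} (hε : 0 < ε) :
    ∃ α : ℝ, 0 < α ∧ ∃ᶠ t in atTop, α ≤ (P.cesaroKernel t z).real (Metric.ball y ε) := by
  obtain ⟨s, hs, hpos⟩ := hy ε hε
  have hKs := P.isMarkovKernel_cesaroKernel hs
  -- A continuous bump, positive exactly on the ball. Then `Q_s g` is continuous and positive at
  -- `z`, hence above some `c > 0` on a ball `B(z, δ)`, and `Q_t g(z)` is close to `Q_t Q_s g(z) ≥ c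
  -- Q_t(z, B(z, δ))`.
  let g : X → ℝ := fun w => max 0 (1 - dist w y / ε)
  have hgc : Continuous g := by fun_prop
  have hg0 : ∀ w, 0 ≤ g w := fun w => le_max_left _ _
  have hg1 : ∀ w, g w ≤ 1 := fun w => max_le zero_le_one (by
    have : 0 ≤ dist w y / ε := by positivity
    linarith)
  have hgC : ∀ w, |g w| ≤ 1 := fun w => by rw [abs_of_nonneg (hg0 w)]; exact hg1 w
  have hgb : ∀ w, g w ≤ (Metric.ball y ε).indicator (fun _ => (1 : ℝ)) w := by
    intro w
    by_cases hw : w ∈ Metric.ball y ε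
    · rw [indicator_of_mem hw]; exact hg1 w
    · rw [indicator_of_notMem hw]
      refine max_le le_rfl ?_
      rw [Metric.mem_ball, not_lt] at hw
      rw [sub_nonpos, le_div_iff₀ hε]
      linarith
  have hint : 0 < ∫ w, g w ∂(P.cesaroKernel s z) := by
    rw [integral_pos_iff_support_of_nonneg hg0 (integrable_of_abs_le _ hgc.measurable hgC)]
    refine hpos.trans_le (measure_mono fun w hw => ?_)
    rw [Metric.mem_ball] at hw
    have : 0 < 1 - dist w y / ε := by rw [sub_pos, div_lt_one hε]; exact hw
    exact (lt_max_of_lt_right this).ne'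
  obtain ⟨c, hc0, hc⟩ := exists_between hint
  obtain ⟨δ, hδ, hball⟩ := Metric.mem_nhds_iff.1
    ((P.continuous_integral_cesaroKernel hs hgc hgC).continuousAt.eventually_const_lt hc)
  obtain ⟨α, hα, hfreq⟩ := hz δ hδ
  refine ⟨c * α / 2, by positivity, ?_⟩
  have hlim : Tendsto (fun t : ℝ => 2 * 1 * s / t) atTop (𝓝 0) :=
    tendsto_const_nhds.div_atTop tendsto_id
  refine (hfreq.and_eventually ((eventually_gt_atTop 0).and
    (hlim.eventually_le_const (show 0 < c * α / 2 by positivity)))).mono ?_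
  rintro t ⟨hαt, ht, hle⟩
  have hKt := P.isMarkovKernel_cesaroKernel ht
  have h1 := P.abs_integral_cesaroKernel_comp_sub_le ht hs hgc.measurable hgC z
  have h2 : ∫ w, g w ∂(P.cesaroKernel t z) ≤ (P.cesaroKernel t z).real (Metric.ball y ε) := by
    calc _ ≤ ∫ w, (Metric.ball y ε).indicator (fun _ => (1 : ℝ)) w ∂(P.cesaroKernel t z) :=
          integral_mono (integrable_of_abs_le _ hgc.measurable hgC)
            ((integrable_const 1).indicator measurableSet_ball) hgb
      _ = _ := by rw [integral_indicator_const _ measurableSet_ball]; simp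
  have h3 : c * (P.cesaroKernel t z).real (Metric.ball z δ)
      ≤ ∫ w, ∫ u, g u ∂(P.cesaroKernel s w) ∂(P.cesaroKernel t z) := by
    calc _ = ∫ w, (Metric.ball z δ).indicator (fun _ => c) w ∂(P.cesaroKernel t z) := by
          rw [integral_indicator_const _ measurableSet_ball, smul_eq_mul, mul_comm]
      _ ≤ _ := by
          refine integral_mono ((integrable_const c).indicator measurableSet_ball)
            (integrable_of_abs_le _ (P.measurable_integral_cesaroKernel s hgc.measurable)
              fun w => abs_integral_le_of_abs_le _ hgC) fun w => ?_
          by_cases hw : w ∈ Metric.ball z δ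
          · rw [indicator_of_mem hw]
            exact le_of_lt (hball hw)
          · rw [indicator_of_notMem hw]
            exact integral_nonneg hg0
  have h4 := (abs_le.1 h1).2
  have h5 := mul_le_mul_of_nonneg_left hαt hc0.le
  linarith

/-- Let `f i` be nonnegative continuous functions with sum at most `1` and let `z` be recurrent.
Then near every reachable point there are reachable points `y` such that `Q_{t i} (f i) (y)` is
small for some large `i`. -/
theorem exists_reachable_integral_lt {z : X}
    (hz : ∀ ε : ℝ, 0 < ε → ∃ α : ℝ, 0 < α ∧
      ∃ᶠ t in atTop, α ≤ (P.cesaroKernel t z).real (Metric.ball z ε))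
    {f : ℕ → X → ℝ} (hf : ∀ i, Continuous (f i)) (hf0 : ∀ i x, 0 ≤ f i x)
    (hf1 : ∀ (s : Finset ℕ) x, ∑ i ∈ s, f i x ≤ 1) {t : ℕ → ℝ} (ht : ∀ i, 0 < t i) {c : ℝ}
    (hc : 0 < c) {y : X} (hy : y ∈ P.reachable z) {ε : ℝ} (hε : 0 < ε) (N : ℕ) :
    ∃ y' ∈ P.reachable z, y' ∈ Metric.ball y ε ∧
      ∃ i ≥ N, ∫ w, f i w ∂(P.cesaroKernel (t i) y') < c := by
  by_contra hcon
  push Not at hcon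
  have hfC : ∀ i x, |f i x| ≤ 1 := fun i x => by
    rw [abs_of_nonneg (hf0 i x)]; simpa using hf1 {i} x
  obtain ⟨α, hα, hfreq⟩ := P.exists_frequently_le_real_ball hz hy hε
  -- If the claim failed, `n` of the functions would each have integral at least `cα/2` against a
  -- common `Q_s(z, ·)`, giving total `ncα/2 > 1`.
  obtain ⟨n, hn⟩ := exists_nat_gt (2 / (c * α))
  have hlim : ∀ i, Tendsto (fun s : ℝ => 2 * 1 * t i / s) atTop (𝓝 0) := fun i =>
    tendsto_const_nhds.div_atTop tendsto_id
  have hev : ∀ᶠ s in atTop, ∀ i ∈ Finset.Ico N (N + n), 2 * 1 * t i / s ≤ c * α / 2 :=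
    (Finset.eventually_all _).2 fun i _ => (hlim i).eventually_le_const (by positivity)
  obtain ⟨s, hαs, hs, hsmall⟩ :=
    (hfreq.and_eventually ((eventually_gt_atTop 0).and hev)).exists
  have hKs := P.isMarkovKernel_cesaroKernel hs
  have hlow : ∀ i ∈ Finset.Ico N (N + n), c * α / 2 ≤ ∫ w, f i w ∂(P.cesaroKernel s z) := by
    intro i hi
    have hKi := P.isMarkovKernel_cesaroKernel (ht i)
    have h1 := P.abs_integral_cesaroKernel_comp_sub_le hs (ht i) (hf i).measurable (hfC i) z
    have h2 : c * (P.cesaroKernel s z).real (Metric.ball y ε)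
        ≤ ∫ w, ∫ u, f i u ∂(P.cesaroKernel (t i) w) ∂(P.cesaroKernel s z) := by
      calc _ = ∫ w, (Metric.ball y ε).indicator (fun _ => c) w ∂(P.cesaroKernel s z) := by
            rw [integral_indicator_const _ measurableSet_ball, smul_eq_mul, mul_comm]
        _ ≤ _ := by
            refine integral_mono_ae ((integrable_const c).indicator measurableSet_ball)
              (integrable_of_abs_le _ (P.measurable_integral_cesaroKernel _ (hf i).measurable)
                fun w => abs_integral_le_of_abs_le _ (hfC i)) ?_
            filter_upwards [P.ae_mem_reachable z hs] with w hwr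
            by_cases hw : w ∈ Metric.ball y ε
            · rw [indicator_of_mem hw]
              exact hcon w hwr hw i (Finset.mem_Ico.1 hi).1
            · rw [indicator_of_notMem hw]
              exact integral_nonneg (hf0 i)
    have h3 := (abs_le.1 h1).2
    have h4 := mul_le_mul_of_nonneg_left hαs hc.le
    have h5 := hsmall i hi
    linarith
  have hsum : ∑ i ∈ Finset.Ico N (N + n), ∫ w, f i w ∂(P.cesaroKernel s z) ≤ 1 := by
    rw [← integral_finsetSum _ fun i _ => integrable_of_abs_le _ (hf i).measurable (hfC i)]
    refine (le_abs_self _).trans (abs_integral_le_of_abs_le _ fun w => ?_)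
    rw [abs_of_nonneg (Finset.sum_nonneg fun i _ => hf0 i w)]
    exact hf1 _ w
  have hge := (Finset.card_nsmul_le_sum _ _ _ hlow).trans hsum
  rw [Nat.card_Ico, Nat.add_sub_cancel_left, nsmul_eq_mul] at hge
  rw [div_lt_iff₀ (by positivity)] at hn
  linarith

/-- At a recurrent point where the semigroup is Cesàro eventually continuous, the time averages
cannot escape along sets that stay a positive distance apart. -/
theorem not_forall_le_integral_thickenedIndicator [CompleteSpace X] {z : X}
    (hP : P.CesaroEventuallyContinuousAt z)
    (hz : ∀ ε : ℝ, 0 < ε → ∃ α : ℝ, 0 < α ∧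
      ∃ᶠ t in atTop, α ≤ (P.cesaroKernel t z).real (Metric.ball z ε))
    {r : ℝ} (hr : 0 < r) {C : ℕ → Set X}
    (hC : Pairwise fun i j => Disjoint (Metric.thickening r (C i)) (Metric.thickening r (C j)))
    {t : ℕ → ℝ} (ht : ∀ i, 0 < t i) (htop : Tendsto t atTop atTop) {c : ℝ} (hc : 0 < c) :
    ¬ ∀ i, c ≤ ∫ w, ((thickenedIndicator hr (C i) w : ℝ≥0) : ℝ) ∂(P.cesaroKernel (t i) z) := by
  intro hlow
  let f : ℕ → X → ℝ := fun i w => ((thickenedIndicator hr (C i) w : ℝ≥0) : ℝ)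
  have hfc : ∀ i, Continuous (f i) := fun i =>
    NNReal.continuous_coe.comp (thickenedIndicator hr (C i)).continuous
  have hf0 : ∀ i x, 0 ≤ f i x := fun i x => NNReal.coe_nonneg _
  choose b hb1 hb using hasSum_coe_thickenedIndicator hr hC
  have hfs : ∀ (s : Finset ℕ) x, ∑ i ∈ s, f i x ≤ 1 := fun s x =>
    (sum_le_hasSum s (fun i _ => hf0 i x) (hb x)).trans (hb1 x)
  have hfC : ∀ i x, |f i x| ≤ 1 := fun i x => by
    rw [abs_of_nonneg (hf0 i x)]; simpa using hfs {i} x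
  have hbf : ∀ x, ∑' l, f l x = b x := fun x => (hb x).tsum_eq
  have hKt := fun i => P.isMarkovKernel_cesaroKernel (ht i)
  have hz' : z ∈ P.reachable z := fun ε hε => by
    obtain ⟨α, hα, h⟩ := hz ε hε
    obtain ⟨s, hs, hs0⟩ := (h.and_eventually (eventually_gt_atTop 0)).exists
    exact ⟨s, hs0, ENNReal.toReal_pos_iff.1 (hα.trans_le hs) |>.1⟩
  have hS := P.isClosed_reachable z
  have : CompleteSpace (P.reachable z) := hS.completeSpace_coe
  -- A point of all the `W N` has small averages for infinitely many `i`; by Baire such points are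
  -- dense among the reachable ones, in particular near `z`.
  let W : ℕ → Set (P.reachable z) := fun N =>
    {y | ∃ i ≥ N, ∫ w, f i w ∂(P.cesaroKernel (t i) y) < c / 2}
  have hWo : ∀ N, IsOpen (W N) := by
    intro N
    have e : W N = ⋃ i, ⋃ (_ : i ≥ N),
        {y : P.reachable z | ∫ w, f i w ∂(P.cesaroKernel (t i) y) < c / 2} := by
      ext y; simp [W]
    rw [e]
    exact isOpen_iUnion fun i => isOpen_iUnion fun _ => isOpen_lt
      ((P.continuous_integral_cesaroKernel (ht i) (hfc i) (hfC i)).comp continuous_subtype_val)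
      continuous_const
  have hWd : ∀ N, Dense (W N) := by
    intro N
    refine Metric.dense_iff.2 fun y ε hε => ?_
    obtain ⟨y', hy', hyb, hi⟩ := P.exists_reachable_integral_lt hz hfc hf0 hfs ht
      (half_pos hc) y.2 hε N
    exact ⟨⟨y', hy'⟩, hyb, hi⟩
  have hdense := dense_iInter_of_isOpen_nat hWo hWd
  have hy : ∀ k : ℕ, ∃ y : X, dist y z < 1 / ((k : ℝ) + 1) ∧
      ∃ᶠ i in atTop, ∫ w, f i w ∂(P.cesaroKernel (t i) y) < c / 2 := by
    intro k
    obtain ⟨y, hyb, hyW⟩ := Metric.dense_iff.1 hdense ⟨z, hz'⟩ (1 / ((k : ℝ) + 1)) (by positivity)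
    exact ⟨y, hyb, frequently_atTop.2 fun N => mem_iInter.1 hyW N⟩
  choose y hyz hyf using hy
  have hsumI : ∀ (I : Set ℕ) (m : Measure X) [IsProbabilityMeasure m],
      HasSum (fun l => I.indicator (fun l => ∫ w, f l w ∂m) l)
        (∫ w, ∑' l, I.indicator (fun l => f l w) l ∂m) := by
    intro I m _
    have h := hasSum_integral_of_dominated_convergence (μ := m)
      (F := fun l w => I.indicator (fun l => f l w) l)
      (f := fun w => ∑' l, I.indicator (fun l => f l w) l) (fun l w => f l w)
      (fun l => by
        by_cases hl : l ∈ I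
        · simpa only [indicator_of_mem hl] using (hfc l).aestronglyMeasurable
        · simpa only [indicator_of_notMem hl] using aestronglyMeasurable_const)
      (fun l => Eventually.of_forall fun w => (norm_indicator_le_norm_self _ _).trans
        (abs_of_nonneg (hf0 l w)).le)
      (Eventually.of_forall fun w => (hb w).summable)
      (by
        simp_rw [hbf]
        refine integrable_of_abs_le m (C := 1) ?_ fun w => ?_
        · have : b = fun w => ∑' l, f l w := funext fun w => (hbf w).symm
          rw [this]
          have := (lipschitzWith_tsum_indicator_thickenedIndicator hr hC univ).continuous.measurable
          simpa only [indicator_univ] using this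
        · rw [abs_of_nonneg ((hb w).nonneg fun l => hf0 l w)]
          exact hb1 w)
      (Eventually.of_forall fun w => ((hb w).summable.indicator I).hasSum)
    have e : I.indicator (fun l => ∫ w, f l w ∂m)
        = fun l => ∫ w, I.indicator (fun l => f l w) l ∂m := by
      refine funext fun l => ?_
      by_cases hl : l ∈ I
      · simp only [indicator_of_mem hl]
      · simp only [indicator_of_notMem hl, integral_zero]
    exact e ▸ h
  have hsum : ∀ (m : Measure X) [IsProbabilityMeasure m], Summable fun l => ∫ w, f l w ∂m := by
    intro m _
    simpa only [indicator_univ] using (hsumI univ m).summable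
  -- One matrix for each `y k`, with diagonal entries at least `c - c/2` infinitely often. A single
  -- `I` must serve all `k`, because the `δ` of eventual continuity depends on the function built
  -- from `I`.
  let a : ℕ → ℕ → ℕ → ℝ := fun k i l =>
    ∫ w, f l w ∂(P.cesaroKernel (t i) z) - ∫ w, f l w ∂(P.cesaroKernel (t i) (y k))
  obtain ⟨I, hI⟩ := exists_set_frequently_le_abs_tsum_indicator (a := a)
    (fun k i => ((hsum _).sub (hsum _)).abs) (half_pos hc) fun k => (hyf k).mono fun i hi =>
      (show c / 2 ≤ _ by have := hlow i; linarith).trans (le_abs_self _)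
  let F : X → ℝ := fun x => ∑' l, I.indicator (fun l => f l x) l
  have hFL : LipschitzWith r.toNNReal⁻¹ F :=
    lipschitzWith_tsum_indicator_thickenedIndicator hr hC I
  have hFC : ∀ x, |F x| ≤ 1 := fun x => by
    rw [abs_of_nonneg (tsum_nonneg fun l => indicator_nonneg (fun l _ => hf0 l x) l)]
    refine (((hb x).summable.indicator I).tsum_le_tsum (fun l => ?_) (hb x).summable).trans
      ((hbf x).le.trans (hb1 x))
    exact indicator_le_self' (fun l _ => hf0 l x) l
  have hFa : ∀ k i, ∑' l, I.indicator (a k i) l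
      = ∫ w, F w ∂(P.cesaroKernel (t i) z) - ∫ w, F w ∂(P.cesaroKernel (t i) (y k)) := by
    intro k i
    rw [← ((hsumI I (P.cesaroKernel (t i) z)).sub (hsumI I (P.cesaroKernel (t i) (y k)))).tsum_eq]
    refine tsum_congr fun l => ?_
    by_cases hl : l ∈ I
    · simp only [indicator_of_mem hl, a]
    · simp only [indicator_of_notMem hl, sub_zero]
  -- Any bound below the `c / 8` supplied by the gliding hump would do.
  obtain ⟨δ, hδ, hcec⟩ := hP (boundedBorel.mk hFL.continuous.measurable hFC) ⟨_, hFL⟩ (c / 16)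
    (by positivity)
  obtain ⟨k, hk⟩ := exists_nat_one_div_lt hδ
  obtain ⟨T, hT⟩ := hcec (y k) ((hyz k).trans hk)
  obtain ⟨i, hi, hiT⟩ := ((hI k).and_eventually (htop.eventually_ge_atTop T)).exists
  have h1 := hT (t i) hiT
  rw [cesaroFun_eq_integral _ (ht i), cesaroFun_eq_integral _ (ht i), abs_sub_comm] at h1
  rw [hFa] at hi
  have h2 : c / 2 / 4 ≤ c / 16 := hi.trans h1
  linarith

/-- The measures `t Q_t(x, ·)` increase with `t`. Thus averages over times in `[1, T]` are dominated
by `T Q_T(x, ·)`, and tightness can fail only through arbitrarily large times. -/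
theorem cesaroKernel_le_mul {s t : ℝ} (hs : 1 ≤ s) (hst : s ≤ t) (x : X) {A : Set X}
    (hA : MeasurableSet A) :
    P.cesaroKernel s x A ≤ ENNReal.ofReal t * P.cesaroKernel t x A := by
  have ht : 0 < t := one_pos.trans_le (hs.trans hst)
  rw [← cesaroMeasure_dirac, ← cesaroMeasure_dirac, cesaroMeasure_apply _ _ _ hA,
    cesaroMeasure_apply _ _ _ hA, ← mul_assoc,
    ENNReal.mul_inv_cancel (by simpa using ht) ENNReal.ofReal_ne_top, one_mul]
  refine (mul_le_of_le_one_left zero_le ?_).trans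
    (lintegral_mono_set (Ioc_subset_Ioc_right hst))
  rw [ENNReal.inv_le_one]
  simpa using hs

/-- At a recurrent point where the semigroup is Cesàro eventually continuous, the time averages
are tight. -/
theorem isTightMeasureSet_cesaroKernel [CompleteSpace X] {z : X}
    (hP : P.CesaroEventuallyContinuousAt z)
    (hz : ∀ ε : ℝ, 0 < ε → ∃ α : ℝ, 0 < α ∧
      ∃ᶠ t in atTop, α ≤ (P.cesaroKernel t z).real (Metric.ball z ε)) :
    IsTightMeasureSet {m | ∃ t : ℝ, 1 ≤ t ∧ m = P.cesaroKernel t z} := by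
  have : Nonempty X := ⟨z⟩
  let d : ℕ → X := TopologicalSpace.denseSeq X
  by_contra hnt
  have h0 := mt (isTightMeasureSet_of_forall_exists_ball (d := d)) hnt
  push Not at h0
  obtain ⟨r, hr, δ, hδ, hbad⟩ := h0
  let B : ℝ → ℕ → Set X := fun ρ n => ⋃ k < n, Metric.ball (d k) ρ
  have hBm : ∀ ρ n, MeasurableSet (B ρ n) := fun ρ n =>
    (isOpen_biUnion fun _ _ => Metric.isOpen_ball).measurableSet
  have hBmono : ∀ ρ, Monotone (B ρ) := fun ρ m n hmn =>
    biUnion_subset_biUnion_left fun k hk => lt_of_lt_of_le hk hmn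
  have hBlim : ∀ ρ : ℝ, 0 < ρ → ∀ t : ℝ, 0 < t →
      Tendsto (fun n => P.cesaroKernel t z (B ρ n)ᶜ) atTop (𝓝 0) := by
    intro ρ hρ t ht
    have := P.isMarkovKernel_cesaroKernel ht
    have h := tendsto_measure_iInter_atTop (μ := P.cesaroKernel t z)
      (s := fun n => (B ρ n)ᶜ) (fun n => (hBm ρ n).compl.nullMeasurableSet)
      (fun m n hmn => compl_subset_compl.2 (hBmono ρ hmn)) ⟨0, measure_ne_top _ _⟩
    have he : ⋂ n, (B ρ n)ᶜ = ∅ := by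
      rw [← compl_iUnion, compl_empty_iff, eq_univ_iff_forall]
      intro x
      obtain ⟨k, hk⟩ := (TopologicalSpace.denseRange_denseSeq X).exists_dist_lt x hρ
      exact mem_iUnion.2 ⟨k + 1, mem_iUnion₂.2 ⟨k, Nat.lt_succ_self k, hk⟩⟩
    rwa [he, measure_empty] at h
  have hbad' : ∀ (n : ℕ) (T : ℝ), ∃ t : ℝ, T ≤ t ∧ 1 ≤ t ∧ δ < P.cesaroKernel t z (B r n)ᶜ := by
    intro n T
    by_contra hcon
    push Not at hcon
    have hlim := ENNReal.Tendsto.const_mul (hBlim r hr (max T 1) (lt_max_of_lt_right one_pos))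
      (Or.inr (ENNReal.ofReal_ne_top (r := max T 1)))
    rw [mul_zero] at hlim
    obtain ⟨m, hm, hnm⟩ := ((hlim.eventually_le_const (pos_iff_ne_zero.2 hδ)).and
      (eventually_ge_atTop n)).exists
    obtain ⟨_, ⟨t, ht, rfl⟩, hlt⟩ := hbad m
    rcases le_total (max T 1) t with hTt | hTt
    · refine (hcon t ((le_max_left _ _).trans hTt) ht).not_gt (hlt.trans_le ?_)
      exact measure_mono (compl_subset_compl.2 (hBmono r hnm))
    · exact ((P.cesaroKernel_le_mul ht hTt z (hBm r m).compl).trans hm).not_gt hlt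
  have hδtop : δ ≠ ∞ := by
    obtain ⟨t, -, -, h⟩ := hbad' 0 0
    exact ne_top_of_lt h
  have hδ2 : 0 < δ / 2 := ENNReal.half_pos hδ
  -- Of the mass above `δ` outside `B r n`, less than or equal to `δ / 2` is lost by truncating to
  -- finitely many balls of the smaller radius.
  have hstep : ∀ (i n : ℕ), ∃ (t : ℝ) (n' : ℕ), (i : ℝ) ≤ t ∧ 1 ≤ t ∧ n ≤ n' ∧
      δ / 2 ≤ P.cesaroKernel t z (B (r / 2) n' \ B r n) := by
    intro i n
    obtain ⟨t, hit, ht, hlt⟩ := hbad' n i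
    obtain ⟨n', hn', hnn'⟩ := (((hBlim (r / 2) (by positivity) t
      (one_pos.trans_le ht)).eventually_le_const hδ2).and (eventually_ge_atTop n)).exists
    refine ⟨t, n', hit, ht, hnn', ?_⟩
    have h1 : (B r n)ᶜ ⊆ (B (r / 2) n' \ B r n) ∪ (B (r / 2) n')ᶜ := by
      intro x hx
      by_cases hx' : x ∈ B (r / 2) n'
      · exact Or.inl ⟨hx', hx⟩
      · exact Or.inr hx'
    have h2 := ((hlt.trans_le (measure_mono h1)).trans_le (measure_union_le _ _)).le.trans
      (add_le_add_right hn' _)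
    refine (ENNReal.add_le_add_iff_right (ENNReal.div_ne_top (y := 2) hδtop (by simp))).1 ?_
    rwa [ENNReal.add_halves]
  choose τ ν hτi hτ1 hν hmass using hstep
  let N : ℕ → ℕ := fun i => Nat.rec 0 ν i
  have hN : Monotone N := monotone_nat_of_le_succ fun i => hν i (N i)
  -- Points of `C i` are within `r / 2` of a centre of index below `N (i + 1)`, whereas points of a
  -- later `C j` are at least `r` from that centre. The sets are thus `r / 2` apart, and their `r /
  -- 4`-thickenings are disjoint.
  let C : ℕ → Set X := fun i => B (r / 2) (N (i + 1)) \ B r (N i)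
  have hsep : ∀ i j, i < j → Disjoint (Metric.thickening (r / 4) (C i))
      (Metric.thickening (r / 4) (C j)) := by
    intro i j hij
    refine disjoint_left.2 fun w hwi hwj => ?_
    obtain ⟨x, hx, hwx⟩ := Metric.mem_thickening_iff.1 hwi
    obtain ⟨x', hx', hwx'⟩ := Metric.mem_thickening_iff.1 hwj
    obtain ⟨k, hk, hxk⟩ := mem_iUnion₂.1 hx.1
    refine hx'.2 (mem_iUnion₂.2 ⟨k, lt_of_lt_of_le hk (hN hij), ?_⟩)
    rw [Metric.mem_ball] at hxk ⊢
    have h1 := dist_triangle4 x' w x (d k)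
    rw [dist_comm x' w] at h1
    linarith
  have hC : Pairwise fun i j => Disjoint (Metric.thickening (r / 4) (C i))
      (Metric.thickening (r / 4) (C j)) := by
    intro i j hij
    rcases lt_or_gt_of_ne hij with h | h
    · exact hsep i j h
    · exact (hsep j i h).symm
  refine P.not_forall_le_integral_thickenedIndicator hP hz (r := r / 4) (by positivity) hC
    (t := fun i => τ i (N i)) (fun i => one_pos.trans_le (hτ1 i (N i)))
    (tendsto_atTop_mono (fun i => hτi i (N i)) tendsto_natCast_atTop_atTop)
    (ENNReal.toReal_pos hδ2.ne' (ENNReal.div_ne_top hδtop (by simp))) fun i => ?_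
  have hK := P.isMarkovKernel_cesaroKernel (one_pos.trans_le (hτ1 i (N i)))
  have hCm : MeasurableSet (C i) := (hBm _ _).diff (hBm _ _)
  refine (ENNReal.toReal_mono (measure_ne_top _ _) (hmass i (N i))).trans ?_
  change (P.cesaroKernel (τ i (N i)) z).real (C i) ≤ _
  rw [← integral_indicator_one hCm]
  refine integral_mono ((integrable_const (1 : ℝ)).indicator hCm)
    (integrable_thickenedIndicator _ _) fun w => ?_
  by_cases hw : w ∈ C i
  · rw [indicator_of_mem hw, thickenedIndicator_one _ _ hw]
    simp
  · rw [indicator_of_notMem hw]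
    exact NNReal.coe_nonneg _

end MarkovFellerSemigroup

/-! ### Uniqueness, support and convergence. -/

namespace MarkovFellerSemigroup

variable {X : Type*} [MetricSpace X] [SecondCountableTopology X] [MeasurableSpace X] [BorelSpace X]
  (P : MarkovFellerSemigroup X)

/-- If a set is visited with positive frequency, then it is charged by `Q_n(x, ·)` for some
positive integer `n`. -/
theorem exists_cesaroKernel_nat_ne_zero {x : X} {A : Set X} (hA : MeasurableSet A)
    (h : ∃ α : ℝ, 0 < α ∧ ∃ᶠ t in atTop, α ≤ (P.cesaroKernel t x).real A) :
    ∃ n : ℕ, P.cesaroKernel (n + 1 : ℕ) x A ≠ 0 := by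
  obtain ⟨α, hα, hf⟩ := h
  obtain ⟨t, ht, ht1⟩ := (hf.and_eventually (eventually_ge_atTop 1)).exists
  refine ⟨⌈t⌉₊, fun h0 => ?_⟩
  have hle : t ≤ (⌈t⌉₊ + 1 : ℕ) := (Nat.le_ceil t).trans (by push_cast; linarith)
  have h1 := P.cesaroKernel_le_mul ht1 hle x hA
  rw [h0, mul_zero, nonpos_iff_eq_zero] at h1
  rw [Measure.real, h1, ENNReal.toReal_zero] at ht
  linarith

/-- A measurable set which is absorbing up to null sets and is reached from every point has full
measure for every invariant probability measure. -/
theorem IsInvariant.ae_mem_of_absorbing {P : MarkovFellerSemigroup X} {ν : ProbabilityMeasure X}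
    (hν : P.IsInvariant ν) {A : Set X} (hA : MeasurableSet A)
    (habs : ∀ n : ℕ, ∀ᵐ x ∂(ν : Measure X), x ∈ A → P.cesaroKernel (n + 1 : ℕ) x Aᶜ = 0)
    (hreach : ∀ x, ∃ n : ℕ, P.cesaroKernel (n + 1 : ℕ) x A ≠ 0) :
    ∀ᵐ x ∂(ν : Measure X), x ∈ A := by
  have hpos : ∀ n : ℕ, (0 : ℝ) < (n + 1 : ℕ) := fun n => by positivity
  have hK := fun n : ℕ => P.isMarkovKernel_cesaroKernel (hpos n)
  -- Absorption gives `≤`, invariance gives equal integrals, hence equality almost everywhere.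
  -- Integer times keep the exceptional sets countable in number.
  have key : ∀ n : ℕ, ∀ᵐ x ∂(ν : Measure X),
      P.cesaroKernel (n + 1 : ℕ) x Aᶜ = Aᶜ.indicator (fun _ => (1 : ℝ≥0∞)) x := by
    intro n
    have hint : ∫⁻ x, P.cesaroKernel (n + 1 : ℕ) x Aᶜ ∂(ν : Measure X) = (ν : Measure X) Aᶜ := by
      rw [← Measure.bind_apply hA.compl (Kernel.aemeasurable _), hν.bind_cesaroKernel (hpos n)]
    refine ae_eq_of_ae_le_of_lintegral_le ?_ ?_ ?_ ?_
    · filter_upwards [habs n] with x hx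
      by_cases hxA : x ∈ A
      · rw [hx hxA]
        exact zero_le
      · rw [indicator_of_mem (show x ∈ Aᶜ from hxA)]
        exact prob_le_one
    · rw [hint]
      exact measure_ne_top _ _
    · exact (measurable_const.indicator hA.compl).aemeasurable
    · rw [hint, lintegral_indicator hA.compl]
      simp
  filter_upwards [ae_all_iff.2 key] with x hx
  by_contra hxA
  obtain ⟨n, hn⟩ := hreach x
  refine hn ((prob_compl_eq_one_iff hA).1 ?_)
  rw [hx n, indicator_of_mem (show x ∈ Aᶜ from hxA)]

/-- The asymptotic oscillation of `Q_n f` between `x` and `z`. -/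
noncomputable def oscillation (f : X → ℝ) (z x : X) : ℝ≥0∞ :=
  limsup (fun k : ℕ => ENNReal.ofReal |∫ y, f y ∂(P.cesaroKernel (k + 1 : ℕ) x)
    - ∫ y, f y ∂(P.cesaroKernel (k + 1 : ℕ) z)|) atTop

variable {f : X → ℝ} {C : ℝ}

theorem measurable_abs_integral_sub (hf : Measurable f) (z : X) (t : ℝ) :
    Measurable fun x => ENNReal.ofReal |∫ y, f y ∂(P.cesaroKernel t x)
      - ∫ y, f y ∂(P.cesaroKernel t z)| :=
  ((P.measurable_integral_cesaroKernel t hf).sub_const _).abs.ennreal_ofReal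

theorem abs_integral_sub_le (hC : ∀ x, |f x| ≤ C) (z x : X) {t : ℝ} (ht : 0 < t) :
    |∫ y, f y ∂(P.cesaroKernel t x) - ∫ y, f y ∂(P.cesaroKernel t z)| ≤ 2 * C := by
  have := P.isMarkovKernel_cesaroKernel ht
  refine (abs_sub _ _).trans ?_
  linarith [abs_integral_le_of_abs_le (P.cesaroKernel t x) hC,
    abs_integral_le_of_abs_le (P.cesaroKernel t z) hC]

theorem measurable_oscillation (hf : Measurable f) (z : X) : Measurable (P.oscillation f z) :=
  Measurable.limsup fun _ => P.measurable_abs_integral_sub hf z _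

theorem oscillation_le (hC : ∀ x, |f x| ≤ C) (z x : X) :
    P.oscillation f z x ≤ ENNReal.ofReal (2 * C) :=
  limsup_le_of_le (by isBoundedDefault) (Eventually.of_forall fun k =>
    ENNReal.ofReal_le_ofReal (P.abs_integral_sub_le hC z x (by positivity)))

/-- The asymptotic oscillation is subharmonic. -/
theorem oscillation_le_lintegral (hf : Measurable f) (hC : ∀ x, |f x| ≤ C) (z x : X) {r : ℝ}
    (hr : 0 < r) :
    P.oscillation f z x ≤ ∫⁻ y, P.oscillation f z y ∂(P.cesaroKernel r x) := by
  have hKr := P.isMarkovKernel_cesaroKernel hr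
  let D : ℕ → X → ℝ≥0∞ := fun k x => ENNReal.ofReal |∫ y, f y ∂(P.cesaroKernel (k + 1 : ℕ) x)
    - ∫ y, f y ∂(P.cesaroKernel (k + 1 : ℕ) z)|
  have hD : ∀ k, D k x ≤ ∫⁻ y, D k y ∂(P.cesaroKernel r x)
      + ENNReal.ofReal (2 * C * r / (k + 1 : ℕ)) := by
    intro k
    have hk : (0 : ℝ) < (k + 1 : ℕ) := by positivity
    have hKk := P.isMarkovKernel_cesaroKernel hk
    have hm := P.measurable_integral_cesaroKernel (k + 1 : ℕ) hf
    have hb : ∀ y, |∫ w, f w ∂(P.cesaroKernel (k + 1 : ℕ) y)| ≤ C := fun y =>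
      abs_integral_le_of_abs_le _ hC
    set b := ∫ y, f y ∂(P.cesaroKernel (k + 1 : ℕ) z)
    have hi : Integrable (fun y => ∫ w, f w ∂(P.cesaroKernel (k + 1 : ℕ) y) - b)
        (P.cesaroKernel r x) := (integrable_of_abs_le _ hm hb).sub (integrable_const b)
    have h1 := P.abs_integral_cesaroKernel_comp_sub_le' hk hr hf hC x
    have h2 : |∫ y, ∫ w, f w ∂(P.cesaroKernel (k + 1 : ℕ) y) ∂(P.cesaroKernel r x) - b|
        ≤ ∫ y, |∫ w, f w ∂(P.cesaroKernel (k + 1 : ℕ) y) - b| ∂(P.cesaroKernel r x) := by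
      have e : ∫ y, ∫ w, f w ∂(P.cesaroKernel (k + 1 : ℕ) y) ∂(P.cesaroKernel r x) - b
          = ∫ y, (∫ w, f w ∂(P.cesaroKernel (k + 1 : ℕ) y) - b) ∂(P.cesaroKernel r x) := by
        rw [integral_sub (integrable_of_abs_le _ hm hb) (integrable_const _)]
        simp
      rw [e]
      exact abs_integral_le_integral_abs
    have h3 : ∫⁻ y, D k y ∂(P.cesaroKernel r x) = ENNReal.ofReal
        (∫ y, |∫ w, f w ∂(P.cesaroKernel (k + 1 : ℕ) y) - b| ∂(P.cesaroKernel r x)) :=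
      (ofReal_integral_eq_lintegral_ofReal hi.abs (Eventually.of_forall fun _ => abs_nonneg _)).symm
    rw [h3, ← ENNReal.ofReal_add (integral_nonneg fun _ => abs_nonneg _)
      ((abs_nonneg _).trans h1)]
    refine ENNReal.ofReal_le_ofReal ?_
    rw [abs_sub_comm] at h1
    have h4 := abs_sub_le (∫ y, f y ∂(P.cesaroKernel (k + 1 : ℕ) x))
      (∫ y, ∫ w, f w ∂(P.cesaroKernel (k + 1 : ℕ) y) ∂(P.cesaroKernel r x)) b
    linarith
  have hlim : Tendsto (fun k : ℕ => ENNReal.ofReal (2 * C * r / (k + 1 : ℕ))) atTop (𝓝 0) := by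
    have h : Tendsto (fun k : ℕ => 2 * C * r / ((k + 1 : ℕ) : ℝ)) atTop (𝓝 0) :=
      tendsto_const_nhds.div_atTop
        (tendsto_natCast_atTop_atTop.comp (tendsto_add_atTop_nat 1))
    simpa using ENNReal.tendsto_ofReal h
  -- The commutation error vanishes in the limit, and the reverse Fatou lemma moves the `limsup`
  -- inside the integral.
  calc P.oscillation f z x ≤ limsup (fun k => ∫⁻ y, D k y ∂(P.cesaroKernel r x)
          + ENNReal.ofReal (2 * C * r / (k + 1 : ℕ))) atTop :=
        limsup_le_limsup (Eventually.of_forall hD)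
    _ = limsup (fun k => ∫⁻ y, D k y ∂(P.cesaroKernel r x)) atTop :=
        ENNReal.limsup_add_of_right_tendsto_zero hlim _
    _ ≤ _ := limsup_lintegral_le (fun _ => ENNReal.ofReal (2 * C))
        (fun k => P.measurable_abs_integral_sub hf z _)
        (fun k => Eventually.of_forall fun y =>
          ENNReal.ofReal_le_ofReal (P.abs_integral_sub_le hC z y (by positivity)))
        (by rw [lintegral_const, measure_univ, mul_one]; exact ENNReal.ofReal_ne_top)

/-- The asymptotic oscillation with respect to a recurrent point vanishes almost everywhere for
every invariant probability measure. -/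
theorem IsInvariant.ae_oscillation_eq_zero {P : MarkovFellerSemigroup X} {ν : ProbabilityMeasure X}
    (hν : P.IsInvariant ν) {z : X} (hP : P.CesaroEventuallyContinuousAt z)
    (hz : ∀ (x : X) (ε : ℝ), 0 < ε → ∃ α : ℝ, 0 < α ∧
      ∃ᶠ t in atTop, α ≤ (P.cesaroKernel t x).real (Metric.ball z ε))
    {K : ℝ≥0} (hf : LipschitzWith K f) (hC : ∀ x, |f x| ≤ C) :
    ∀ᵐ x ∂(ν : Measure X), P.oscillation f z x = 0 := by
  have hm : Measurable f := hf.continuous.measurable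
  have hGm := P.measurable_oscillation hm z
  have key : ∀ m : ℕ, ∀ᵐ x ∂(ν : Measure X),
      P.oscillation f z x ≤ ENNReal.ofReal (1 / ((m : ℝ) + 1)) := by
    intro m
    set ε := ENNReal.ofReal (1 / ((m : ℝ) + 1))
    let A : Set X := {x | P.oscillation f z x ≤ ε}
    have hA : MeasurableSet A := measurableSet_le hGm measurable_const
    -- The truncated excess `h = (G - ε)⁺` of the oscillation `G` is subharmonic too. Invariance
    -- forces `h = Q_n h` almost everywhere, so from almost every zero of `h` the average `Q_n`
    -- charges only zeros of `h`: `A` is absorbing.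
    let h : X → ℝ≥0∞ := fun x => P.oscillation f z x - ε
    have hhm : Measurable h := hGm.sub_const ε
    have hA0 : ∀ x, x ∈ A ↔ h x = 0 := fun x =>
      (tsub_eq_zero_iff_le (a := P.oscillation f z x) (b := ε)).symm
    refine hν.ae_mem_of_absorbing hA (fun n => ?_) fun x => ?_
    · have hn : (0 : ℝ) < (n + 1 : ℕ) := by positivity
      have hK := P.isMarkovKernel_cesaroKernel hn
      have hsub : ∀ x, h x ≤ ∫⁻ y, h y ∂(P.cesaroKernel (n + 1 : ℕ) x) := by
        intro x
        calc h x ≤ ∫⁻ y, P.oscillation f z y ∂(P.cesaroKernel (n + 1 : ℕ) x)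
              - ∫⁻ _, ε ∂(P.cesaroKernel (n + 1 : ℕ) x) := by
              rw [lintegral_const, measure_univ, mul_one]
              exact tsub_le_tsub_right (P.oscillation_le_lintegral hm hC z x hn) _
          _ ≤ _ := lintegral_sub_le _ _ measurable_const
      have hint : ∫⁻ x, ∫⁻ y, h y ∂(P.cesaroKernel (n + 1 : ℕ) x) ∂(ν : Measure X)
          = ∫⁻ x, h x ∂(ν : Measure X) := by
        rw [← Measure.lintegral_bind (Kernel.aemeasurable _) hhm.aemeasurable,
          hν.bind_cesaroKernel hn]
      have hfin : ∫⁻ x, h x ∂(ν : Measure X) ≠ ∞ := by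
        refine ne_top_of_le_ne_top (ENNReal.ofReal_ne_top (r := 2 * C))
          ((lintegral_mono fun x => tsub_le_self.trans (P.oscillation_le hC z x)).trans_eq ?_)
        rw [lintegral_const, measure_univ, mul_one]
      have hae := ae_eq_of_ae_le_of_lintegral_le (Eventually.of_forall hsub) hfin
        hhm.lintegral_kernel.aemeasurable hint.le
      filter_upwards [hae] with x hx hxA
      rw [(hA0 x).1 hxA, eq_comm, lintegral_eq_zero_iff hhm] at hx
      refine measure_mono_null (fun y hy => ?_) (ae_iff.1 hx)
      exact fun hy0 => hy ((hA0 y).2 hy0)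
    -- Eventual continuity puts a ball about `z` inside `A`, and every point reaches that ball.
    · obtain ⟨δ, hδ, hcec⟩ := hP (boundedBorel.mk hm hC) ⟨K, hf⟩ (1 / ((m : ℝ) + 1))
        (by positivity)
      obtain ⟨n, hn⟩ := P.exists_cesaroKernel_nat_ne_zero measurableSet_ball (hz x δ hδ)
      have hball : Metric.ball z δ ⊆ A := fun y hy => ?_
      · exact ⟨n, fun h0 => hn (measure_mono_null hball h0)⟩
      change P.oscillation f z y ≤ ε
      obtain ⟨T, hT⟩ := hcec y hy
      refine limsup_le_of_le (by isBoundedDefault) ?_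
      filter_upwards [eventually_ge_atTop ⌈T⌉₊] with k hk
      have hk0 : (0 : ℝ) < (k + 1 : ℕ) := by positivity
      have h1 := hT (k + 1 : ℕ) ((Nat.le_ceil T).trans (by exact_mod_cast hk.trans k.le_succ))
      rw [cesaroFun_eq_integral _ hk0, cesaroFun_eq_integral _ hk0] at h1
      exact ENNReal.ofReal_le_ofReal h1
  have hlim : Tendsto (fun m : ℕ => ENNReal.ofReal (1 / ((m : ℝ) + 1))) atTop (𝓝 0) := by
    simpa using ENNReal.tendsto_ofReal tendsto_one_div_add_atTop_nhds_zero_nat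
  filter_upwards [ae_all_iff.2 key] with x hx
  exact nonpos_iff_eq_zero.1 (ge_of_tendsto' hlim hx)

/-- The time averages at a recurrent point determine the integrals of the bounded Lipschitz
functions with respect to every invariant probability measure. -/
theorem IsInvariant.tendsto_integral_cesaroKernel {P : MarkovFellerSemigroup X}
    {ν : ProbabilityMeasure X} (hν : P.IsInvariant ν) {z : X}
    (hP : P.CesaroEventuallyContinuousAt z)
    (hz : ∀ (x : X) (ε : ℝ), 0 < ε → ∃ α : ℝ, 0 < α ∧
      ∃ᶠ t in atTop, α ≤ (P.cesaroKernel t x).real (Metric.ball z ε))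
    {K : ℝ≥0} (hf : LipschitzWith K f) (hC : ∀ x, |f x| ≤ C) :
    Tendsto (fun k : ℕ => ∫ y, f y ∂(P.cesaroKernel (k + 1 : ℕ) z)) atTop
      (𝓝 (∫ y, f y ∂(ν : Measure X))) := by
  have hm : Measurable f := hf.continuous.measurable
  have h0 := hν.ae_oscillation_eq_zero hP hz hf hC
  have hlim := tendsto_integral_of_dominated_convergence (μ := (ν : Measure X))
    (F := fun (k : ℕ) x => ∫ y, f y ∂(P.cesaroKernel (k + 1 : ℕ) x)
      - ∫ y, f y ∂(P.cesaroKernel (k + 1 : ℕ) z)) (f := fun _ => 0) (fun _ => 2 * C)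
    (fun k => ((P.measurable_integral_cesaroKernel _ hm).sub_const _).aestronglyMeasurable)
    (integrable_const _)
    (fun k => Eventually.of_forall fun x => P.abs_integral_sub_le hC z x (by positivity))
    (by
      filter_upwards [h0] with x hx
      have h1 : Tendsto (fun k : ℕ => ENNReal.ofReal |∫ y, f y ∂(P.cesaroKernel (k + 1 : ℕ) x)
          - ∫ y, f y ∂(P.cesaroKernel (k + 1 : ℕ) z)|) atTop (𝓝 0) :=
        tendsto_of_le_liminf_of_limsup_le zero_le hx.le
      have h2 := (ENNReal.tendsto_toReal ENNReal.zero_ne_top).comp h1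
      refine (tendsto_zero_iff_abs_tendsto_zero _).2 ?_
      refine h2.congr fun k => ?_
      simp [ENNReal.toReal_ofReal (abs_nonneg _)])
  rw [integral_zero] at hlim
  have e : ∀ k : ℕ, ∫ x, (∫ y, f y ∂(P.cesaroKernel (k + 1 : ℕ) x)
      - ∫ y, f y ∂(P.cesaroKernel (k + 1 : ℕ) z)) ∂(ν : Measure X)
      = ∫ y, f y ∂(ν : Measure X) - ∫ y, f y ∂(P.cesaroKernel (k + 1 : ℕ) z) := by
    intro k
    have hk : (0 : ℝ) < (k + 1 : ℕ) := by positivity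
    have hK := P.isMarkovKernel_cesaroKernel hk
    rw [integral_sub (integrable_of_abs_le _ (P.measurable_integral_cesaroKernel _ hm)
      fun x => abs_integral_le_of_abs_le _ hC) (integrable_const _),
      ← integral_bind_kernel (ν : Measure X) (P.cesaroKernel (k + 1 : ℕ)) hm hC,
      hν.bind_cesaroKernel hk]
    simp
  simp_rw [e] at hlim
  simpa using (tendsto_const_nhds (x := ∫ y, f y ∂(ν : Measure X))).sub hlim

theorem IsInvariant.eq_of_recurrent {P : MarkovFellerSemigroup X} {μ ν : ProbabilityMeasure X}
    (hμ : P.IsInvariant μ) (hν : P.IsInvariant ν) {z : X} (hP : P.CesaroEventuallyContinuousAt z)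
    (hz : ∀ (x : X) (ε : ℝ), 0 < ε → ∃ α : ℝ, 0 < α ∧
      ∃ᶠ t in atTop, α ≤ (P.cesaroKernel t x).real (Metric.ball z ε)) :
    μ = ν := by
  -- Both integrals of a bounded Lipschitz function are limits of the same sequence at `z`. The
  -- Lipschitz criterion for weak convergence, applied to a constant sequence, then identifies the
  -- measures.
  have h : Tendsto (fun _ : ℕ => μ) atTop (𝓝 ν) := by
    refine tendsto_iff_forall_lipschitz_integral_tendsto.2 fun f ⟨D, hD⟩ ⟨K, hK⟩ => ?_
    have hC : ∀ x, |f x| ≤ D + |f z| := fun x => by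
      have h1 := hD x z
      have h2 := abs_sub_abs_le_abs_sub (f x) (f z)
      rw [Real.dist_eq] at h1
      linarith
    rw [tendsto_nhds_unique (hμ.tendsto_integral_cesaroKernel hP hz hK hC)
      (hν.tendsto_integral_cesaroKernel hP hz hK hC)]
    exact tendsto_const_nhds
  exact tendsto_nhds_unique tendsto_const_nhds h

/-- If `μ` missed a ball about `z`, invariance would make that ball null for every `Q_n(x, ·)`, for
almost every `x`, against recurrence. -/
theorem IsInvariant.mem_support {P : MarkovFellerSemigroup X} {μ : ProbabilityMeasure X}
    (hμ : P.IsInvariant μ) {z : X}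
    (hz : ∀ (x : X) (ε : ℝ), 0 < ε → ∃ α : ℝ, 0 < α ∧
      ∃ᶠ t in atTop, α ≤ (P.cesaroKernel t x).real (Metric.ball z ε)) :
    z ∈ (μ : Measure X).support := by
  refine (Measure.mem_support_iff_forall z).2 fun U hU => ?_
  obtain ⟨ε, hε, hball⟩ := Metric.mem_nhds_iff.1 hU
  refine lt_of_lt_of_le (pos_iff_ne_zero.2 fun h0 => ?_) (measure_mono hball)
  have hae : ∀ n : ℕ, ∀ᵐ x ∂(μ : Measure X),
      P.cesaroKernel (n + 1 : ℕ) x (Metric.ball z ε) = 0 := by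
    intro n
    have h1 := hμ.bind_cesaroKernel (t := (n + 1 : ℕ)) (by positivity)
    rw [← h1, Measure.bind_apply measurableSet_ball (Kernel.aemeasurable _),
      lintegral_eq_zero_iff (Kernel.measurable_coe _ measurableSet_ball)] at h0
    exact h0
  obtain ⟨x, hx⟩ := (ae_all_iff.2 hae).exists
  obtain ⟨n, hn⟩ := P.exists_cesaroKernel_nat_ne_zero measurableSet_ball (hz x ε hε)
  exact hn (hx n)

/-- If `μ` is the only invariant probability measure, then the time averages of every measure
supported by the points with tight time averages converge weakly to `μ`. -/
theorem tendsto_integral_cesaroMeasure {μ : ProbabilityMeasure X}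
    (hμ : ∀ μ', P.IsInvariant μ' → μ' = μ) {ν : ProbabilityMeasure X}
    (hν : (ν : Measure X).support ⊆ P.tightPoints) (f : BoundedContinuousFunction X ℝ) :
    Tendsto (fun t : ℝ => ∫ x, f x ∂(P.cesaroMeasure t ν)) atTop
      (𝓝 (∫ x, f x ∂(μ : Measure X))) := by
  have hm : Measurable f := f.continuous.measurable
  have hC : ∀ x, |f x| ≤ ‖f‖ := f.norm_coe_le_norm
  have hpt : ∀ x ∈ P.tightPoints, Tendsto (fun t : ℝ => ∫ y, f y ∂(P.cesaroKernel t x)) atTop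
      (𝓝 (∫ x, f x ∂(μ : Measure X))) := by
    intro x hx
    have ht : IsTightMeasureSet {m | ∃ t : ℝ, 1 ≤ t ∧ m = P.cesaroKernel t x} := by
      refine hx.subset ?_
      rintro _ ⟨t, ht, rfl⟩
      exact ⟨t, one_pos.trans_le ht, (P.cesaroMeasure_dirac t x).symm⟩
    refine (ProbabilityMeasure.tendsto_iff_forall_integral_tendsto.1
      (P.tendsto_cesaroProba_of_unique ht hμ) f).congr' ?_
    filter_upwards [eventually_ge_atTop 1] with t ht
    rw [coe_cesaroProba, max_eq_left ht]
  have hlim : Tendsto (fun t : ℝ => ∫ x, ∫ y, f y ∂(P.cesaroKernel t x) ∂(ν : Measure X)) atTop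
      (𝓝 (∫ _, ∫ y, f y ∂(μ : Measure X) ∂(ν : Measure X))) := by
    refine tendsto_integral_filter_of_dominated_convergence (fun _ => ‖f‖)
      (Eventually.of_forall fun t => (P.measurable_integral_cesaroKernel t hm).aestronglyMeasurable)
      ?_ (integrable_const _) ?_
    · filter_upwards [eventually_gt_atTop 0] with t ht
      have := P.isMarkovKernel_cesaroKernel ht
      exact Eventually.of_forall fun x => abs_integral_le_of_abs_le _ hC
    · filter_upwards [(Measure.support_mem_ae : (ν : Measure X).support ∈ ae (ν : Measure X))]
        with x hx
      exact hpt x (hν hx)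
  rw [integral_const, probReal_univ, one_smul] at hlim
  refine hlim.congr' ?_
  filter_upwards [eventually_gt_atTop 0] with t ht
  have := P.isMarkovKernel_cesaroKernel ht
  rw [cesaroMeasure_eq_bind, integral_bind_kernel _ _ hm hC]

end MarkovFellerSemigroup

/-! ### The theorem. -/

theorem theorem1p2 {X : Type*} [MetricSpace X] [CompleteSpace X]
    [TopologicalSpace.SeparableSpace X] [MeasurableSpace X] [BorelSpace X]
    (P : MarkovFellerSemigroup X) (hP : ∀ z : X, P.CesaroEventuallyContinuousAt z) :
    (∀ z : X,
      (∀ ε : ℝ, 0 < ε →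
        0 < limsup (fun t : ℝ => P.cesaroMeasure t (diracProba z) (Metric.ball z ε)) atTop) →
      P.tightPoints.Nonempty ∧ ∃ μ : ProbabilityMeasure X, P.IsInvariant μ) ∧
    (∀ z : X,
      (∀ (x : X) (ε : ℝ), 0 < ε →
        0 < limsup (fun t : ℝ => P.cesaroMeasure t (diracProba x) (Metric.ball z ε)) atTop) →
      ∃ μ : ProbabilityMeasure X,
        P.IsInvariant μ ∧
        (∀ μ' : ProbabilityMeasure X, P.IsInvariant μ' → μ' = μ) ∧
        z ∈ (μ : Measure X).support ∧
        ∀ ν : ProbabilityMeasure X, (ν : Measure X).support ⊆ P.tightPoints →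
          ∀ f : BoundedContinuousFunction X ℝ,
            Tendsto (fun t : ℝ => ∫ x, f x ∂(P.cesaroMeasure t ν)) atTop
              (𝓝 (∫ x, f x ∂(μ : Measure X)))) := by
  have : SecondCountableTopology X := UniformSpace.secondCountable_of_separable X
  have hexists : ∀ z : X,
      (∀ ε : ℝ, 0 < ε →
        0 < limsup (fun t : ℝ => P.cesaroMeasure t (diracProba z) (Metric.ball z ε)) atTop) →
      ∃ μ : ProbabilityMeasure X, P.IsInvariant μ := fun z hz =>
    P.exists_isInvariant_of_isTightMeasureSet (P.isTightMeasureSet_cesaroKernel (hP z)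
      fun ε hε => P.exists_frequently_le_real_of_limsup_pos (hz ε hε))
  refine ⟨fun z hz => ?_, fun z hz => ?_⟩
  · obtain ⟨μ, hμ⟩ := hexists z hz
    -- The tight point need not be `z`, whose averages are controlled only for `t ≥ 1`.
    exact ⟨(P.ae_mem_tightPoints hμ).exists, μ, hμ⟩
  · obtain ⟨μ, hμ⟩ := hexists z (hz z)
    have hz' := fun (x : X) (ε : ℝ) (hε : 0 < ε) =>
      P.exists_frequently_le_real_of_limsup_pos (hz x ε hε)
    have huniq : ∀ μ', P.IsInvariant μ' → μ' = μ := fun μ' hμ' =>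
      hμ'.eq_of_recurrent hμ (hP z) hz'
    exact ⟨μ, hμ, huniq, hμ.mem_support hz', fun ν hν f =>
      P.tendsto_integral_cesaroMeasure huniq hν f⟩
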